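/- Let $M$ be a smooth Hausdorff manifold without boundary, modelled on a Banach space (for example a finite-dimensional manifold), and let $g$ be a pseudo-Riemannian metric on $M$, i.e. a smooth field of continuous symmetric bilinear forms $g_x$ on $T_xM$ with $g_x(v,\cdot)=0\Rightarrow v=0$. Let $m:\mathbb R_{>0}\times M\to M$ be a smooth free action, $m_\lambda=m(\lambda,\cdot)$, and $P_x=\frac{d}{dt}m(e^t,x)|_{t=0}$ its generating vector field. Let $f:M\to\mathbb R_{>0}$ be smooth and $\alpha\in\mathbb R\setminus\{0\}$, and suppose that $(g,f)$ is a homogeneous pair of degree $\alpha$: $m_\lambda^*g=\lambda^\alpha g$, $m_\lambda^*f=\lambda^\alpha f$ for all $\lambda>0$, and $g(P,\cdot)=df$. For $l>0$ let $M_l=\{x\in M: f(x)=l\}$, with the metric $g_l$ induced by $g$. Let $\beta\in\mathbb R$, $x_0\in M_l$, $A\in T_{x_0}M$, and put $$B=A-\frac{df(A)}{\alpha l}P_{x_0}\in\ker (df)_{x_0}=T_{x_0}M_l,\qquad \mu(\beta,t)=1+\frac{df(A)}{l}(\beta+1)t+\frac{\alpha}{4l}g(A,A)(\beta+1)^2t^2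 .$$ Let $I\ni 0$ be an open interval and $\gamma$ a curve in $M$ defined on $I$. **Proposition 3.16.** (1) Let $\beta\neq-1$. Then $\gamma$ is a geodesic of $f^\beta g$ on $I$ with $\gamma(0)=x_0$, $\dot\gamma(0)=A$ if and only if $\mu(\beta,t)>0$ for all $t\in I$ and there is a geodesic $\hat y_l$ of $(M_l,g_l)$ with $\hat y_l(0)=x_0$, $\dot{\hat y}_l(0)=B$, defined on an open interval $J\ni0$, such that for all $t\in I$ one has $\int_0^t\frac{d\tau}{\mu(\beta,\tau)}\in J$ and $$\gamma(t)=m\left(\mu(\beta,t)^{\frac1{\alpha(\beta+1)}},\ \hat y_l\left(\int_0^t\frac{d\tau}{\mu(\beta,\tau)}\right)\right).$$ (2) Let $\beta=-1$. Then $\gamma$ is a geodesic of $f^{-1}g$ on $I$ with $\gamma(0)=x_0$, $\dot\gamma(0)=A$ if and only if there is a geodesic $\hat y_l$ of $(M_l,g_l)$ with $\hat y_l(0)=x_0$, $\dot{\hat y}_l(0)=B$, defined on an open interval $J\supseteq I$, such that for all $t\in I$ $$\gamma(t)=m\left(e^{\frac{df(A)}{\alpha l}t},\ \hat y_l(t)\right).$$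 (3) Suppose in addition that every map $T_xM\to T_x^*M$, $v\mapsto g_x(v,\cdot)$ is surjective (this is automatic if $\dim M<\infty$). If $\gamma$ is a geodesic of $f^\beta g$ on $I$ with $\gamma(0)=x_0$, $\dot\gamma(0)=A$, and $\hat y_l$ is any geodesic of $(M_l,g_l)$ on an open interval $J\ni 0$ with $\hat y_l(0)=x_0$, $\dot{\hat y}_l(0)=B$, then the formula for $\gamma(t)$ in (1) (if $\beta\ne-1$), respectively in (2) (if $\beta=-1$), holds for every $t\in I$ with $\int_0^t\frac{d\tau}{\mu(\beta,\tau)}\in J$, respectively $t\in I\cap J$. -/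

import Mathlib

open Set Filter
open scoped Topology Manifold ContDiff

noncomputable section

namespace HomogPair

/-! Throughout, a manifold is a smooth manifold without boundary modelled on a Banach space `E`;
the finite-dimensional manifolds are the case where `E` is finite-dimensional. -/

/-- A pseudo-Riemannian metric on `M`: a smooth field of continuous, symmetric, nondegenerate
bilinear forms on the tangent spaces. -/
structure PseudoRiemannianMetric (E : Type*) [NormedAddCommGroup E] [NormedSpace ℝ E]
    (M : Type*) [TopologicalSpace M] [ChartedSpace E M] [IsManifold 𝓘(ℝ, E) ∞ M] where
  form : ∀ x : M, TangentSpace 𝓘(ℝ, E) x →L[ℝ] TangentSpace 𝓘(ℝ, E) x →L[ℝ] ℝ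
  symm : ∀ (x : M) (v w : TangentSpace 𝓘(ℝ, E) x), form x v w = form x w v
  nondegenerate : ∀ (x : M) (v : TangentSpace 𝓘(ℝ, E) x), (∀ w, form x v w = 0) → v = 0
  contMDiff : ContMDiff 𝓘(ℝ, E) (𝓘(ℝ, E).prod 𝓘(ℝ, E →L[ℝ] E →L[ℝ] ℝ)) ∞
    (fun x : M ↦ (⟨x, form x⟩ : Bundle.TotalSpace (E →L[ℝ] E →L[ℝ] ℝ)
      (fun x : M ↦ TangentSpace 𝓘(ℝ, E) x →L[ℝ] TangentSpace 𝓘(ℝ, E) x →L[ℝ] ℝ)))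

/-- A free smooth action `m : ℝ_{>0} × M → M` of the multiplicative group of positive reals.
The values `m a` for `a ≤ 0` play no role. -/
structure IsFreePosAction (E : Type*) [NormedAddCommGroup E] [NormedSpace ℝ E]
    {M : Type*} [TopologicalSpace M] [ChartedSpace E M] (m : ℝ → M → M) : Prop where
  one_act : ∀ x, m 1 x = x
  mul_act : ∀ a b : ℝ, 0 < a → 0 < b → ∀ x, m (a * b) x = m a (m b x)
  smooth : ContMDiffOn (𝓘(ℝ, ℝ).prod 𝓘(ℝ, E)) 𝓘(ℝ, E) ∞
    (fun p : ℝ × M ↦ m p.1 p.2) (Ioi 0 ×ˢ univ)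
  free : ∀ a : ℝ, 0 < a → ∀ x, m a x = x → a = 1

section

variable {E : Type*} [NormedAddCommGroup E] [NormedSpace ℝ E]
  {M : Type*} [TopologicalSpace M] [ChartedSpace E M]

/-- The vector field `P_x = d/dt m(e^t, x) |_{t = 0}` generated by the action `m`.
(The derivative is a tangent vector at `m (e^0) x`, which is the point `x`.) -/
def generator (E : Type*) [NormedAddCommGroup E] [NormedSpace ℝ E]
    {M : Type*} [TopologicalSpace M] [ChartedSpace E M] (m : ℝ → M → M) (x : M) :
    TangentSpace 𝓘(ℝ, E) x :=
  mfderiv 𝓘(ℝ, ℝ) 𝓘(ℝ, E) (fun t : ℝ ↦ m (Real.exp t) x) 0 (1 : ℝ)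

/-- The differential `(df)_x (A)` of a real function, as a real number. -/
def dReal (f : M → ℝ) (x : M) (A : TangentSpace 𝓘(ℝ, E) x) : ℝ :=
  mfderiv 𝓘(ℝ, E) 𝓘(ℝ, ℝ) f x A

/-- `(g, f)` is a homogeneous pair of degree `α` for the action `m`: `f` is smooth and positive,
`α ≠ 0`, and `m_a^* g = a^α g`, `m_a^* f = a^α f` for all `a > 0`, and `g(P, ·) = df`. -/
structure IsHomogeneousPair [IsManifold 𝓘(ℝ, E) ∞ M] (m : ℝ → M → M)
    (g : PseudoRiemannianMetric E M) (f : M → ℝ) (α : ℝ) : Prop where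
  degree_ne_zero : α ≠ 0
  smooth : ContMDiff 𝓘(ℝ, E) 𝓘(ℝ, ℝ) ∞ f
  pos : ∀ x, 0 < f x
  metric_homog : ∀ a : ℝ, 0 < a → ∀ (x : M) (v w : TangentSpace 𝓘(ℝ, E) x),
    g.form (m a x) (mfderiv 𝓘(ℝ, E) 𝓘(ℝ, E) (m a) x v) (mfderiv 𝓘(ℝ, E) 𝓘(ℝ, E) (m a) x w)
      = a ^ α * g.form x v w
  fun_homog : ∀ a : ℝ, 0 < a → ∀ x, f (m a x) = a ^ α * f x
  generator_dual : ∀ (x : M) (v : TangentSpace 𝓘(ℝ, E) x),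
    g.form x (generator E m x) v = dReal f x v

/-- The conformally changed metric `f^β g`, as a field of bilinear forms. -/
def conformal [IsManifold 𝓘(ℝ, E) ∞ M] (g : PseudoRiemannianMetric E M) (f : M → ℝ) (β : ℝ)
    (x : M) : TangentSpace 𝓘(ℝ, E) x →L[ℝ] TangentSpace 𝓘(ℝ, E) x →L[ℝ] ℝ :=
  (f x ^ β) • g.form x

/-- The position and velocity `(γ t, γ' t)` of a curve in `M`, a point of the tangent bundle. -/
def velocity (E : Type*) [NormedAddCommGroup E] [NormedSpace ℝ E]
    {M : Type*} [TopologicalSpace M] [ChartedSpace E M] (γ : ℝ → M) (t : ℝ) :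
    TangentBundle 𝓘(ℝ, E) M :=
  ⟨γ t, mfderiv 𝓘(ℝ, ℝ) 𝓘(ℝ, E) γ t (1 : ℝ)⟩

/-! ### Geodesics in coordinates -/

/-- The Christoffel symbols of the first kind of the metric `G` on (an open subset of) the normed
space `F`: `½ (D_u G(v, w) + D_v G(u, w) - D_w G(u, v))` at `x`, that is, `G(∇_u v, w)` for
constant `u`, `v`, `w` and the Levi-Civita connection `∇` of `G`. -/
def christoffel {F : Type*} [NormedAddCommGroup F] [NormedSpace ℝ F]
    (G : F → F →L[ℝ] F →L[ℝ] ℝ) (x u v w : F) : ℝ :=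
  (fderiv ℝ G x u v w + fderiv ℝ G x v u w - fderiv ℝ G x w u v) / 2

/-- The geodesic equation `∇_{u'} u' = 0` at time `t` for the metric `G` on (an open subset of)
`F`, paired by `G` with all vectors `w`: `G(u'', w) + Γ(u', u'; w) = 0`. As `G` is nondegenerate,
nothing is lost by the pairing. -/
def GeodesicEqAt {F : Type*} [NormedAddCommGroup F] [NormedSpace ℝ F]
    (G : F → F →L[ℝ] F →L[ℝ] ℝ) (u : ℝ → F) (t : ℝ) : Prop :=
  ∀ w : F, G (u t) (deriv (deriv u) t) w + christoffel G (u t) (deriv u t) (deriv u t) w = 0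

/-- The pullback `φ^* h` of a field `h` of bilinear forms on `M` by a map `φ : F → M`:
`(φ^* h)_u (v, w) = h (dφ_u v, dφ_u w)`. -/
def pullbackForm {F : Type*} [NormedAddCommGroup F] [NormedSpace ℝ F]
    (h : ∀ x : M, TangentSpace 𝓘(ℝ, E) x →L[ℝ] TangentSpace 𝓘(ℝ, E) x →L[ℝ] ℝ)
    (φ : F → M) (u : F) : F →L[ℝ] F →L[ℝ] ℝ :=
  let B : E →L[ℝ] E →L[ℝ] ℝ := h (φ u)
  let D : F →L[ℝ] E := mfderiv 𝓘(ℝ, F) 𝓘(ℝ, E) φ u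
  B.bilinearComp D D

/-- `γ` restricted to the open set `I` of times is a (smooth) geodesic of `(M, h)`: it is smooth,
and at each time its expression in the chart around its position solves the geodesic equation of
the coordinate expression of `h`. -/
def IsGeodesicOn
    (h : ∀ x : M, TangentSpace 𝓘(ℝ, E) x →L[ℝ] TangentSpace 𝓘(ℝ, E) x →L[ℝ] ℝ)
    (γ : ℝ → M) (I : Set ℝ) : Prop :=
  ContMDiffOn 𝓘(ℝ, ℝ) 𝓘(ℝ, E) ∞ γ I ∧
  ∀ t ∈ I, GeodesicEqAt (pullbackForm h (extChartAt 𝓘(ℝ, E) (γ t)).symm)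
    (fun s ↦ extChartAt 𝓘(ℝ, E) (γ t) (γ s)) t

/-! ### Geodesics of a submanifold with the induced metric -/

/-- `φ`, restricted to the open set `U` of the normed space `F`, is a local parametrization (the
inverse of a chart) of the submanifold `S` of `M`: it is smooth, its differentials are injective
with complemented range (that is, they have continuous linear left inverses), and it is a
homeomorphism of `U` onto a relatively open subset of `S`. -/
structure IsLocalParametrization (E : Type*) [NormedAddCommGroup E] [NormedSpace ℝ E]
    {M : Type*} [TopologicalSpace M] [ChartedSpace E M]
    {F : Type*} [NormedAddCommGroup F] [NormedSpace ℝ F]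
    (S : Set M) (φ : F → M) (U : Set F) : Prop where
  isOpen : IsOpen U
  smooth : ContMDiffOn 𝓘(ℝ, F) 𝓘(ℝ, E) ∞ φ U
  immersion : ∀ u ∈ U, ∃ L : TangentSpace 𝓘(ℝ, E) (φ u) →L[ℝ] F,
    ∀ v : F, L (mfderiv 𝓘(ℝ, F) 𝓘(ℝ, E) φ u v) = v
  isOpenEmbedding : ∃ hS : MapsTo φ U S, Topology.IsOpenEmbedding (hS.restrict φ U S)

/-- The curve `c` restricted to the open set `J` of times is a (smooth) geodesic of the
submanifold `S` of `M` with the metric induced by `h`: at each time there is a local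
parametrization `φ` of `S` around its position in which `c` is given by a smooth curve `u` that
solves the geodesic equation of `φ^* h`, the coordinate expression of the induced metric.
(The parameter spaces can be taken among the linear subspaces of the model space of `M`.) -/
def IsSubmanifoldGeodesicOn
    (h : ∀ x : M, TangentSpace 𝓘(ℝ, E) x →L[ℝ] TangentSpace 𝓘(ℝ, E) x →L[ℝ] ℝ)
    (S : Set M) (c : ℝ → M) (J : Set ℝ) : Prop :=
  ∀ t ∈ J, ∃ (F : Submodule ℝ E) (φ : F → M) (U : Set F) (u : ℝ → F),
    IsLocalParametrization E S φ U ∧ u t ∈ U ∧ ContDiffAt ℝ ∞ u t ∧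
    (∀ᶠ s in 𝓝 t, c s = φ (u s)) ∧ GeodesicEqAt (pullbackForm h φ) u t

/-- The level set `M_l = {x | f x = l}`. -/
def levelSet (f : M → ℝ) (l : ℝ) : Set M := {x | f x = l}

end

/-- A nonempty open interval of times, bounded or not, that contains `0`. -/
def IsTimeInterval (I : Set ℝ) : Prop := IsOpen I ∧ I.OrdConnected ∧ (0 : ℝ) ∈ I

/-- `μ(β, t) = 1 + (a / l) (β + 1) t + (α / (4 l)) q (β + 1)² t²`, to be used with `a = df(A)` and
`q = g(A, A)`. -/
def mu (α l a q β t : ℝ) : ℝ :=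
  1 + a / l * (β + 1) * t + α / (4 * l) * q * (β + 1) ^ 2 * t ^ 2

end HomogPair

end

/-! The proof rests on polar coordinates. Let `φ` parametrize the level set `f = l` locally, and
write points as `m (e^s) (φ v)`. Euler's relation `df(P) = α f` and `g(P, ·) = df` give `g(P, P) = α
f`, and they make `P` orthogonal to the level sets. By homogeneity `f^β g` therefore becomes the
warped metric `l^β e^{k s} (G₀ + α l ds²)`, where `k = α (β + 1)` and `G₀` is the induced metric
(`IsHomogeneousPair.pullbackForm_conformal`).

For a curve `(σ, v)` the geodesic equation of this metric splits in two
(`IsLocalParametrization.geodesicEqAt_iff`). The horizontal part says that `v` is a geodesic of `G₀`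
up to a term `k σ' v'`; the time change with `τ' = e^{-k σ}` removes that term
(`geodesicEqAt_reparam_iff`). The radial part is `α l σ'' + (k / 2) (α l σ'² - Q) = 0` with `Q =
G₀(v', v')`.

Conservation of energy, `e^{k σ} (Q + α l σ'²) = g(A, A)`, eliminates `Q`: the function `W = e^{k
σ}` has constant second derivative, hence is a quadratic polynomial, and its initial data identify
it with `μ` (`IsGeodesicOn.exp_radialLog_eq_mu`). So `μ > 0` and `τ' = 1 / μ`. Conversely, `σ = log
μ / k` solves the radial equation when the level set geodesic starts with velocity `B`
(`radial_log_mu`). If `β = -1`, then `k = 0`: `σ` is linear and time is unchanged.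

Both directions transport the geodesic equation itself, without uniqueness of geodesics, which may
fail for a weakly nondegenerate metric. Uniqueness (`IsGeodesicOn.eqOn`) enters only in the last
claims, where surjectivity of `g` turns the equation into an ODE. -/

noncomputable section

namespace HomogPair

set_option maxSynthPendingDepth 3

/-! ### Geodesic equations on normed spaces: pullback, warped metrics, reparametrization, uniqueness
-/

section Flat

variable {E : Type*} [NormedAddCommGroup E] [NormedSpace ℝ E]
  {F : Type*} [NormedAddCommGroup F] [NormedSpace ℝ F]

/-- The left-hand side of the geodesic equation, paired with `w`. -/
def geodesicDefect (G : F → F →L[ℝ] F →L[ℝ] ℝ) (u : ℝ → F) (t : ℝ) (w : F) : ℝ :=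
  G (u t) (deriv (deriv u) t) w + christoffel G (u t) (deriv u t) (deriv u t) w

theorem geodesicEqAt_iff_geodesicDefect {G : F → F →L[ℝ] F →L[ℝ] ℝ} {u : ℝ → F} {t : ℝ} :
    GeodesicEqAt G u t ↔ ∀ w, geodesicDefect G u t w = 0 :=
  Iff.rfl

/-- The geodesic defect only depends on the germs of the metric and of the curve. -/
theorem geodesicDefect_congr {G G' : F → F →L[ℝ] F →L[ℝ] ℝ} {u u' : ℝ → F} {t : ℝ}
    (hu : u =ᶠ[𝓝 t] u') (hG : G =ᶠ[𝓝 (u t)] G') (w : F) :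
    geodesicDefect G u t w = geodesicDefect G' u' t w := by
  have h0 := hu.eq_of_nhds
  have h1 := hu.deriv.eq_of_nhds
  have h2 := hu.deriv.deriv.eq_of_nhds
  have h3 := hG.eq_of_nhds
  have h4 := hG.fderiv_eq (𝕜 := ℝ)
  simp only [geodesicDefect, christoffel, h3, h4, ← h1, ← h2, ← h0]

theorem contDiffAt_deriv {m n : ℕ∞ω} {u : ℝ → F} {t : ℝ} (hu : ContDiffAt ℝ n u t)
    (hmn : m + 1 ≤ n) : ContDiffAt ℝ m (deriv u) t := by
  have h : ContDiffAt ℝ m (fun s ↦ fderiv ℝ u s 1) t :=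
    (hu.fderiv_right hmn).clm_apply contDiffAt_const
  simpa only [fderiv_apply_one_eq_deriv] using h

theorem hasDerivAt_deriv_of_contDiffAt {u : ℝ → F} {t : ℝ} (hu : ContDiffAt ℝ 2 u t) :
    HasDerivAt (deriv u) (deriv (deriv u) t) t :=
  ((contDiffAt_deriv (m := 1) hu (by norm_num)).differentiableAt one_ne_zero).hasDerivAt

theorem eventually_differentiableAt {n : ℕ∞ω} {f : E → F} {x : E} (hf : ContDiffAt ℝ n f x)
    (hn : 1 ≤ n) : ∀ᶠ y in 𝓝 x, DifferentiableAt ℝ f y := by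
  filter_upwards [(hf.of_le hn).eventually (by simp)] with y hy
  exact hy.differentiableAt one_ne_zero

/-- Smoothness of the pullback of a field of bilinear forms. -/
theorem contDiffAt_bilinearComp {n : ℕ∞ω} {H : F → E →L[ℝ] E →L[ℝ] ℝ} {A : F → F →L[ℝ] E} {x : F}
    (hH : ContDiffAt ℝ n H x) (hA : ContDiffAt ℝ n A x) :
    ContDiffAt ℝ n (fun y ↦ (H y).bilinearComp (A y) (A y)) x := by
  -- Composition acts on the first argument only; a flip brings the second argument into that
  -- position, and a second flip restores the order.
  have h1 : ContDiffAt ℝ n (fun y ↦ (ContinuousLinearMap.flipₗᵢ ℝ F E ℝ) ((H y).comp (A y))) x :=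
    (ContinuousLinearMap.flipₗᵢ ℝ F E ℝ).contDiff.contDiffAt.comp x (hH.clm_comp hA)
  exact (ContinuousLinearMap.flipₗᵢ ℝ F F ℝ).contDiff.contDiffAt.comp x (h1.clm_comp hA)

theorem fderiv_apply_apply {G : F → E →L[ℝ] E →L[ℝ] ℝ} {x : F} (hG : DifferentiableAt ℝ G x)
    (a : F) (b c : E) : fderiv ℝ G x a b c = fderiv ℝ (fun y ↦ G y b c) x a := by
  have h := (hG.hasFDerivAt.clm_apply (hasFDerivAt_const b x)).clm_apply (hasFDerivAt_const c x)
  rw [h.fderiv]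
  simp

/-- The derivative of the pullback of a field of bilinear forms. -/
theorem fderiv_pullback {H : E → E →L[ℝ] E →L[ℝ] ℝ} {Φ : F → E} {x : F}
    (hH : ContDiffAt ℝ 1 H (Φ x)) (hΦ : ContDiffAt ℝ 2 Φ x) (a b c : F) :
    fderiv ℝ (fun y ↦ (H (Φ y)).bilinearComp (fderiv ℝ Φ y) (fderiv ℝ Φ y)) x a b c =
      fderiv ℝ H (Φ x) (fderiv ℝ Φ x a) (fderiv ℝ Φ x b) (fderiv ℝ Φ x c) +
      H (Φ x) (fderiv ℝ (fderiv ℝ Φ) x a b) (fderiv ℝ Φ x c) +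
      H (Φ x) (fderiv ℝ Φ x b) (fderiv ℝ (fderiv ℝ Φ) x a c) := by
  have hD : ContDiffAt ℝ 1 (fderiv ℝ Φ) x := hΦ.fderiv_right (by norm_num)
  have hH' : ContDiffAt ℝ 1 (fun y ↦ H (Φ y)) x := hH.comp x (hΦ.of_le (by norm_num))
  have hdiff := (contDiffAt_bilinearComp hH' hD).differentiableAt one_ne_zero
  rw [fderiv_apply_apply hdiff]
  simp only [ContinuousLinearMap.bilinearComp_apply]
  have hD' := (hD.differentiableAt one_ne_zero).hasFDerivAt
  have h1 := (hH.differentiableAt one_ne_zero).hasFDerivAt.comp x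
    (hΦ.differentiableAt two_ne_zero).hasFDerivAt
  have h := (h1.clm_apply (hD'.clm_apply (hasFDerivAt_const b x))).clm_apply
    (hD'.clm_apply (hasFDerivAt_const c x))
  simp only [Function.comp_def] at h
  rw [h.fderiv]
  simp
  ring

/-- The geodesic defect is natural under pullback. -/
theorem geodesicDefect_pullback {H : E → E →L[ℝ] E →L[ℝ] ℝ} {Φ : F → E} {u : ℝ → F} {t : ℝ}
    (hH : ContDiffAt ℝ 1 H (Φ (u t))) (hs : ∀ a b, H (Φ (u t)) a b = H (Φ (u t)) b a)
    (hΦ : ContDiffAt ℝ 2 Φ (u t)) (hu : ContDiffAt ℝ 2 u t) (w : F) :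
    geodesicDefect (fun y ↦ (H (Φ y)).bilinearComp (fderiv ℝ Φ y) (fderiv ℝ Φ y)) u t w =
      geodesicDefect H (fun s ↦ Φ (u s)) t (fderiv ℝ Φ (u t) w) := by
  have hsymm : IsSymmSndFDerivAt ℝ Φ (u t) := hΦ.isSymmSndFDerivAt (by simp)
  have hud : DifferentiableAt ℝ u t := hu.differentiableAt two_ne_zero
  have hd1 : deriv (fun s ↦ Φ (u s)) =ᶠ[𝓝 t] fun s ↦ fderiv ℝ Φ (u s) (deriv u s) := by
    filter_upwards [eventually_differentiableAt hu (by norm_num),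
      hu.continuousAt.eventually (eventually_differentiableAt hΦ (by norm_num))] with s h1 h2
    exact (h2.hasFDerivAt.comp_hasDerivAt s h1.hasDerivAt).deriv
  have hD' := ((hΦ.fderiv_right (m := 1) (by norm_num)).differentiableAt one_ne_zero).hasFDerivAt
  have hd2 : deriv (deriv (fun s ↦ Φ (u s))) t =
      fderiv ℝ (fderiv ℝ Φ) (u t) (deriv u t) (deriv u t) +
        fderiv ℝ Φ (u t) (deriv (deriv u) t) := by
    rw [hd1.deriv_eq]
    exact ((hD'.comp_hasDerivAt t hud.hasDerivAt).clm_apply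
      (hasDerivAt_deriv_of_contDiffAt hu)).deriv
  simp only [geodesicDefect, christoffel, hd2, hd1.eq_of_nhds, fderiv_pullback hH hΦ,
    ContinuousLinearMap.bilinearComp_apply, map_add, add_apply]
  -- The second derivative of `Φ` in the directions `u'`, `w` occurs in three products. They cancel
  -- by the symmetry of `H` and of the second derivative, leaving only the term `D²Φ(u', u')` that
  -- belongs to the acceleration of `Φ ∘ u`.
  have e1 := hs (fderiv ℝ Φ (u t) (deriv u t)) (fderiv ℝ (fderiv ℝ Φ) (u t) (deriv u t) w)
  have e2 := hs (fderiv ℝ Φ (u t) (deriv u t)) (fderiv ℝ (fderiv ℝ Φ) (u t) w (deriv u t))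
  have e3 : fderiv ℝ (fderiv ℝ Φ) (u t) w (deriv u t) =
    fderiv ℝ (fderiv ℝ Φ) (u t) (deriv u t) w := hsymm _ _
  rw [e3] at e2 ⊢
  rw [e1]
  ring

/-- Conservation of energy. -/
theorem hasDerivAt_energy {G : F → F →L[ℝ] F →L[ℝ] ℝ} {u : ℝ → F} {t : ℝ}
    (hG : ContDiffAt ℝ 1 G (u t)) (hs : ∀ a b, G (u t) a b = G (u t) b a)
    (hu : ContDiffAt ℝ 2 u t) :
    HasDerivAt (fun s ↦ G (u s) (deriv u s) (deriv u s))
      (2 * geodesicDefect G u t (deriv u t)) t := by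
  have hud : DifferentiableAt ℝ u t := hu.differentiableAt two_ne_zero
  have h2 := hasDerivAt_deriv_of_contDiffAt hu
  have h := (((hG.differentiableAt one_ne_zero).hasFDerivAt.comp_hasDerivAt t
    hud.hasDerivAt).clm_apply h2).clm_apply h2
  refine h.congr_deriv ?_
  simp only [geodesicDefect, christoffel, add_apply, Function.comp_apply]
  rw [hs (deriv u t)]
  ring

/-- The metric `c e^{k σ} (G₀ + p dσ²)` on `ℝ × F`. -/
def warpedForm (c k p : ℝ) (G₀ : F → F →L[ℝ] F →L[ℝ] ℝ) (x : ℝ × F) :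
    (ℝ × F) →L[ℝ] (ℝ × F) →L[ℝ] ℝ :=
  (c * Real.exp (k * x.1)) •
    ((G₀ x.2).bilinearComp (ContinuousLinearMap.snd ℝ ℝ F) (ContinuousLinearMap.snd ℝ ℝ F) +
      p • (ContinuousLinearMap.mul ℝ ℝ).bilinearComp (ContinuousLinearMap.fst ℝ ℝ F)
        (ContinuousLinearMap.fst ℝ ℝ F))

theorem warpedForm_apply (c k p : ℝ) (G₀ : F → F →L[ℝ] F →L[ℝ] ℝ) (x v w : ℝ × F) :
    warpedForm c k p G₀ x v w = c * Real.exp (k * x.1) * (G₀ x.2 v.2 w.2 + p * (v.1 * w.1)) := by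
  simp [warpedForm]
  ring

theorem contDiffAt_warpedForm {c k p : ℝ} {G₀ : F → F →L[ℝ] F →L[ℝ] ℝ} {x : ℝ × F}
    (hG : ContDiffAt ℝ 1 G₀ x.2) : ContDiffAt ℝ 1 (warpedForm c k p G₀) x := by
  refine ContDiffAt.smul (contDiffAt_const.mul (contDiffAt_const.mul contDiffAt_fst).exp)
    (ContDiffAt.add ?_ contDiffAt_const)
  exact contDiffAt_bilinearComp (hG.comp x contDiffAt_snd) contDiffAt_const

theorem fderiv_warpedForm {c k p : ℝ} {G₀ : F → F →L[ℝ] F →L[ℝ] ℝ} {x : ℝ × F}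
    (hG : ContDiffAt ℝ 1 G₀ x.2) (a v w : ℝ × F) :
    fderiv ℝ (warpedForm c k p G₀) x a v w = c * Real.exp (k * x.1) *
      (k * a.1 * (G₀ x.2 v.2 w.2 + p * (v.1 * w.1)) + fderiv ℝ G₀ x.2 a.2 v.2 w.2) := by
  rw [fderiv_apply_apply ((contDiffAt_warpedForm hG).differentiableAt one_ne_zero)]
  simp only [warpedForm_apply]
  have h1 : HasFDerivAt (fun y : ℝ × F ↦ c * Real.exp (k * y.1))
      (c • (Real.exp (k * x.1) • (k • ContinuousLinearMap.fst ℝ ℝ F))) x :=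
    ((((ContinuousLinearMap.fst ℝ ℝ F).hasFDerivAt (x := x)).const_mul k).exp).const_mul c
  have h2 := ((hG.differentiableAt one_ne_zero).hasFDerivAt.comp x
    ((ContinuousLinearMap.snd ℝ ℝ F).hasFDerivAt (x := x)))
  have h3 := (h2.clm_apply (hasFDerivAt_const v.2 x)).clm_apply (hasFDerivAt_const w.2 x)
  have h := h1.mul (h3.add_const (p * (v.1 * w.1)))
  have h' : HasFDerivAt (fun y : ℝ × F ↦
    c * Real.exp (k * y.1) * (G₀ y.2 v.2 w.2 + p * (v.1 * w.1))) _ x := h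
  rw [h'.fderiv]
  simp
  ring

/-- The geodesic defect of a warped metric. -/
theorem geodesicDefect_warpedForm {c k p : ℝ} {G₀ : F → F →L[ℝ] F →L[ℝ] ℝ} {σ : ℝ → ℝ} {v : ℝ → F}
    {t : ℝ} (hG : ContDiffAt ℝ 1 G₀ (v t)) (hσ : ContDiffAt ℝ 2 σ t)
    (hv : ContDiffAt ℝ 2 v t) (w : ℝ × F) :
    geodesicDefect (warpedForm c k p G₀) (fun s ↦ (σ s, v s)) t w = c * Real.exp (k * σ t) *
      (geodesicDefect G₀ v t w.2 + k * deriv σ t * G₀ (v t) (deriv v t) w.2 +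
        (p * deriv (deriv σ) t + k / 2 * (p * deriv σ t ^ 2 - G₀ (v t) (deriv v t) (deriv v t)))
          * w.1) := by
  have hd1 : deriv (fun s ↦ (σ s, v s)) =ᶠ[𝓝 t] fun s ↦ (deriv σ s, deriv v s) := by
    filter_upwards [eventually_differentiableAt hσ (by norm_num),
      eventually_differentiableAt hv (by norm_num)] with s h1 h2
    exact (h1.hasDerivAt.prodMk h2.hasDerivAt).deriv
  have hd2 : deriv (deriv (fun s ↦ (σ s, v s))) t = (deriv (deriv σ) t, deriv (deriv v) t) := by
    rw [hd1.deriv_eq]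
    exact ((hasDerivAt_deriv_of_contDiffAt hσ).prodMk (hasDerivAt_deriv_of_contDiffAt hv)).deriv
  simp only [geodesicDefect, christoffel, hd2, hd1.eq_of_nhds, warpedForm_apply,
    fderiv_warpedForm (x := (σ t, v t)) hG]
  ring

/-- The effect of a change of parameter on the geodesic defect. -/
theorem geodesicDefect_comp {G : F → F →L[ℝ] F →L[ℝ] ℝ} {u : ℝ → F} {τ : ℝ → ℝ} {t : ℝ}
    (hu : ContDiffAt ℝ 2 u (τ t)) (hτ : ContDiffAt ℝ 2 τ t) (w : F) :
    geodesicDefect G (fun s ↦ u (τ s)) t w = deriv τ t ^ 2 * geodesicDefect G u (τ t) w +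
      deriv (deriv τ) t * G (u (τ t)) (deriv u (τ t)) w := by
  have hd1 : deriv (fun s ↦ u (τ s)) =ᶠ[𝓝 t] fun s ↦ deriv τ s • deriv u (τ s) := by
    filter_upwards [eventually_differentiableAt hτ (by norm_num),
      hτ.continuousAt.eventually (eventually_differentiableAt hu (by norm_num))] with s h1 h2
    exact (h2.hasDerivAt.scomp s h1.hasDerivAt).deriv
  have hd2 : deriv (deriv (fun s ↦ u (τ s))) t =
      deriv τ t • deriv τ t • deriv (deriv u) (τ t) + deriv (deriv τ) t • deriv u (τ t) := by
    rw [hd1.deriv_eq]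
    exact ((hasDerivAt_deriv_of_contDiffAt hτ).smul ((hasDerivAt_deriv_of_contDiffAt hu).scomp t
      (hτ.differentiableAt two_ne_zero).hasDerivAt)).deriv
  simp only [geodesicDefect, christoffel, hd2, hd1.eq_of_nhds, map_add, map_smul,
    add_apply, smul_apply, smul_eq_mul]
  ring

/-- Local uniqueness of geodesics of a strongly nondegenerate metric. -/
theorem geodesic_eventuallyEq [CompleteSpace E] {H : E → E →L[ℝ] E →L[ℝ] ℝ} {u₁ u₂ : ℝ → E} {t : ℝ}
    (hH : ContDiffAt ℝ 2 H (u₁ t)) (hb : Function.Bijective (H (u₁ t)))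
    (hu₁ : ContDiffAt ℝ 2 u₁ t) (hu₂ : ContDiffAt ℝ 2 u₂ t)
    (h0 : u₁ t = u₂ t) (h1 : deriv u₁ t = deriv u₂ t)
    (he₁ : ∀ᶠ s in 𝓝 t, GeodesicEqAt H u₁ s) (he₂ : ∀ᶠ s in 𝓝 t, GeodesicEqAt H u₂ s) :
    u₁ =ᶠ[𝓝 t] u₂ := by
  set x₀ := u₁ t with hx₀
  let e : E ≃L[ℝ] (E →L[ℝ] ℝ) := ContinuousLinearEquiv.ofBijective (H x₀)
    (LinearMap.ker_eq_bot.2 hb.1) (LinearMap.range_eq_top.2 hb.2)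
  have he : (e : E →L[ℝ] (E →L[ℝ] ℝ)) = H x₀ := ContinuousLinearEquiv.coe_ofBijective _ _ _
  -- the functional `w ↦ Γ(v, v; w)`
  let Γ : E × E → E →L[ℝ] ℝ := fun z ↦
    fderiv ℝ H z.1 z.2 z.2 - (1 / 2 : ℝ) • ((fderiv ℝ H z.1).flip z.2).flip z.2
  -- The geodesic spray: the equation solved for `u''`, as a first-order system in position and
  -- velocity. `inverse` takes the value zero at noninvertible operators, which is harmless because
  -- `H` stays invertible near `x₀`.
  let V : E × E → E × E := fun z ↦ (z.2, -(H z.1).inverse (Γ z))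
  have hΓ : ∀ x v w, Γ (x, v) w = christoffel H x v v w := by
    intro x v w
    simp [Γ, christoffel]
    ring
  have hDH : ContDiffAt ℝ 1 (fderiv ℝ H) x₀ := hH.fderiv_right (by norm_num)
  have hV : ContDiffAt ℝ 1 V (x₀, deriv u₁ t) := by
    have hD : ContDiffAt ℝ 1 (fun z : E × E ↦ fderiv ℝ H z.1) (x₀, deriv u₁ t) :=
      ContDiffAt.comp (x₀, deriv u₁ t) (g := fderiv ℝ H) (f := Prod.fst) hDH contDiffAt_fst
    have hH' : ContDiffAt ℝ 1 (fun z : E × E ↦ H z.1) (x₀, deriv u₁ t) :=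
      ContDiffAt.comp (x₀, deriv u₁ t) (g := H) (f := Prod.fst) (hH.of_le (by norm_num))
        contDiffAt_fst
    have hs : ContDiffAt ℝ 1 (fun z : E × E ↦ z.2) (x₀, deriv u₁ t) := contDiffAt_snd
    have hinv : ContDiffAt ℝ 1 (fun z : E × E ↦ (H z.1).inverse) (x₀, deriv u₁ t) := by
      have : ContDiffAt ℝ 1 ContinuousLinearMap.inverse (H x₀) := by
        rw [← he]; exact contDiffAt_map_inverse e
      exact ContDiffAt.comp (x₀, deriv u₁ t) this hH'
    have hΓs : ContDiffAt ℝ 1 Γ (x₀, deriv u₁ t) := by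
      have h1 : ContDiffAt ℝ 1 (fun z : E × E ↦ (fderiv ℝ H z.1).flip z.2) (x₀, deriv u₁ t) :=
        ((ContinuousLinearMap.flipₗᵢ ℝ E E (E →L[ℝ] ℝ)).contDiff.contDiffAt.comp _ hD).clm_apply hs
      have h2 : ContDiffAt ℝ 1 (fun z : E × E ↦ ((fderiv ℝ H z.1).flip z.2).flip z.2)
          (x₀, deriv u₁ t) :=
        ((ContinuousLinearMap.flipₗᵢ ℝ E E ℝ).contDiff.contDiffAt.comp _ h1).clm_apply hs
      exact ((hD.clm_apply hs).clm_apply hs).sub (h2.const_smul (1 / 2 : ℝ))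
    exact hs.prodMk (hinv.clm_apply hΓs).neg
  obtain ⟨K, S, hS, hLip⟩ := hV.exists_lipschitzOnWith
  have hinvert : ∀ᶠ x in 𝓝 x₀, (H x).IsInvertible := by
    have := hH.continuousAt.preimage_mem_nhds (he ▸ e.nhds)
    filter_upwards [this] with x ⟨e', he'⟩
    exact ⟨e', he'⟩
  have key : ∀ u : ℝ → E, ContDiffAt ℝ 2 u t → u t = x₀ → deriv u t = deriv u₁ t →
      (∀ᶠ s in 𝓝 t, GeodesicEqAt H u s) →
      ∀ᶠ s in 𝓝 t, HasDerivAt (fun s ↦ (u s, deriv u s)) (V (u s, deriv u s)) s ∧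
        (u s, deriv u s) ∈ S := by
    intro u hu hu0 hu1 heq
    have hcont : ContinuousAt (fun s ↦ (u s, deriv u s)) t :=
      hu.continuousAt.prodMk (hasDerivAt_deriv_of_contDiffAt hu).continuousAt
    have hSu : ∀ᶠ s in 𝓝 t, (u s, deriv u s) ∈ S :=
      hcont.eventually_mem (by rw [hu0, hu1]; exact hS)
    have hin : ∀ᶠ s in 𝓝 t, (H (u s)).IsInvertible :=
      hu.continuousAt.eventually (by rw [hu0]; exact hinvert)
    filter_upwards [hSu, hin, heq, hu.eventually (by simp)] with s hs1 hs2 hs3 hs4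
    refine ⟨?_, hs1⟩
    have hd := (hs4.differentiableAt two_ne_zero).hasDerivAt.prodMk
      (hasDerivAt_deriv_of_contDiffAt hs4)
    refine hd.congr_deriv (Prod.ext rfl ?_)
    change deriv (deriv u) s = -(H (u s)).inverse (Γ (u s, deriv u s))
    have : Γ (u s, deriv u s) = - H (u s) (deriv (deriv u) s) := by
      ext w
      have := hs3 w
      rw [hΓ, neg_apply]
      linarith
    rw [this, map_neg, neg_neg]
    obtain ⟨e', he'⟩ := hs2
    rw [← he', ContinuousLinearMap.inverse_equiv]
    simp
  have hfin := ODE_solution_unique_of_eventually (v := fun _ ↦ V) (s := fun _ ↦ S)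
    (Eventually.of_forall fun _ ↦ hLip) (key u₁ hu₁ rfl rfl he₁)
    (key u₂ hu₂ h0.symm h1.symm he₂) (by simp only [← h0, ← h1, ← hx₀])
  filter_upwards [hfin] with s hs
  exact congrArg Prod.fst hs

end Flat

/-! ### Differentials and velocities with values in the model spaces -/

section Derivative

variable {E : Type*} [NormedAddCommGroup E] [NormedSpace ℝ E]
  {M : Type*} [TopologicalSpace M] [ChartedSpace E M]
  {E' : Type*} [NormedAddCommGroup E'] [NormedSpace ℝ E']
  {M' : Type*} [TopologicalSpace M'] [ChartedSpace E' M']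
  {E'' : Type*} [NormedAddCommGroup E''] [NormedSpace ℝ E'']
  {M'' : Type*} [TopologicalSpace M''] [ChartedSpace E'' M'']
  {F : Type*} [NormedAddCommGroup F] [NormedSpace ℝ F]

/-- The differential of a map of manifolds, as a map of the model spaces. -/
def tder (φ : M' → M) (x : M') : E' →L[ℝ] E := mfderiv 𝓘(ℝ, E') 𝓘(ℝ, E) φ x

/-- The types mention only the model spaces, so base points such as `m 1 x` and `x` can be rewritten
inside these formulas; the dependent type of `mfderiv` would obstruct this. -/
theorem tder_comp {φ : M' → M} {ψ : M'' → M'} {x : M''}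
    (hφ : MDifferentiableAt 𝓘(ℝ, E') 𝓘(ℝ, E) φ (ψ x))
    (hψ : MDifferentiableAt 𝓘(ℝ, E'') 𝓘(ℝ, E') ψ x) (v : E'') :
    (tder (fun y ↦ φ (ψ y)) x : E'' →L[ℝ] E) v =
      (tder φ (ψ x) : E' →L[ℝ] E) ((tder ψ x : E'' →L[ℝ] E') v) :=
  congrArg (fun L : E'' →L[ℝ] E ↦ L v) (mfderiv_comp x hφ hψ)

theorem tder_eq_fderiv (φ : F → E') (x : F) : (tder φ x : F →L[ℝ] E') = fderiv ℝ φ x :=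
  mfderiv_eq_fderiv

theorem tder_congr {φ ψ : M' → M} {x : M'} (h : φ =ᶠ[𝓝 x] ψ) :
    (tder φ x : E' →L[ℝ] E) = tder ψ x :=
  h.mfderiv_eq

theorem tder_id (x : M) (v : E) : (tder (fun y : M ↦ y) x : E →L[ℝ] E) v = v :=
  congrArg (fun L : E →L[ℝ] E ↦ L v) (mfderiv_id (I := 𝓘(ℝ, E)) (x := x))

theorem eventually_mdifferentiableAt [IsManifold 𝓘(ℝ, E) ∞ M] [IsManifold 𝓘(ℝ, E') ∞ M']
    {n : ℕ∞ω} (hn : 1 ≤ n) {φ : M' → M} {u : M'}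
    (hφ : ContMDiffAt 𝓘(ℝ, E') 𝓘(ℝ, E) n φ u) :
    ∀ᶠ y in 𝓝 u, MDifferentiableAt 𝓘(ℝ, E') 𝓘(ℝ, E) φ y := by
  have : IsManifold 𝓘(ℝ, E) 1 M := IsManifold.of_le (n := ∞) (by simp)
  have : IsManifold 𝓘(ℝ, E') 1 M' := IsManifold.of_le (n := ∞) (by simp)
  filter_upwards [(contMDiffAt_iff_contMDiffAt_nhds (by simp)).1 (hφ.of_le hn)] with y hy
  exact hy.mdifferentiableAt one_ne_zero

/-- The bilinear form at a point, on the model space. -/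
def bil (h : ∀ x : M, TangentSpace 𝓘(ℝ, E) x →L[ℝ] TangentSpace 𝓘(ℝ, E) x →L[ℝ] ℝ) (x : M) :
    E →L[ℝ] E →L[ℝ] ℝ := h x

/-- The velocity of a curve as an element of the model space. -/
def vel (E : Type*) [NormedAddCommGroup E] [NormedSpace ℝ E]
    {M : Type*} [TopologicalSpace M] [ChartedSpace E M] (γ : ℝ → M) (t : ℝ) : E :=
  (tder γ t : ℝ →L[ℝ] E) 1

theorem velocity_eq_iff {γ : ℝ → M} {t : ℝ} {x : M} {A : TangentSpace 𝓘(ℝ, E) x} :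
    velocity E γ t = ⟨x, A⟩ ↔ γ t = x ∧ vel E γ t = (A : E) := by
  constructor
  · intro h
    have h1 : γ t = x := congrArg Bundle.TotalSpace.proj h
    subst h1
    exact ⟨rfl, (Bundle.TotalSpace.mk_inj).1 h⟩
  · rintro ⟨rfl, h⟩
    exact (Bundle.TotalSpace.mk_inj).2 h

theorem vel_congr {γ γ' : ℝ → M} {t : ℝ} (h : γ =ᶠ[𝓝 t] γ') : vel E γ t = vel E γ' t := by
  rw [vel, tder_congr h, vel]

theorem vel_comp {φ : M' → M} {u : ℝ → M'} {t : ℝ}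
    (hφ : MDifferentiableAt 𝓘(ℝ, E') 𝓘(ℝ, E) φ (u t))
    (hu : MDifferentiableAt 𝓘(ℝ, ℝ) 𝓘(ℝ, E') u t) :
    vel E (fun s ↦ φ (u s)) t = (tder φ (u t) : E' →L[ℝ] E) (vel E' u t) :=
  tder_comp hφ hu 1

theorem vel_eq_deriv (u : ℝ → F) (t : ℝ) : vel F u t = deriv u t := by
  rw [vel, tder_eq_fderiv, fderiv_apply_one_eq_deriv]

end Derivative

/-! ### Geodesics and energy on a manifold, read in charts and parametrizations -/

section Manifold

variable {E : Type*} [NormedAddCommGroup E] [NormedSpace ℝ E]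
  {M : Type*} [TopologicalSpace M] [ChartedSpace E M]
  {F : Type*} [NormedAddCommGroup F] [NormedSpace ℝ F]

theorem pullbackForm_apply
    (h : ∀ x : M, TangentSpace 𝓘(ℝ, E) x →L[ℝ] TangentSpace 𝓘(ℝ, E) x →L[ℝ] ℝ)
    (φ : F → M) (u v w : F) :
    pullbackForm h φ u v w =
      bil h (φ u) ((tder φ u : F →L[ℝ] E) v) ((tder φ u : F →L[ℝ] E) w) :=
  rfl

/-- Symmetry of a field of bilinear forms. -/
def SymmForms (h : ∀ x : M, TangentSpace 𝓘(ℝ, E) x →L[ℝ] TangentSpace 𝓘(ℝ, E) x →L[ℝ] ℝ) : Prop :=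
  ∀ (x : M) (v w : E), bil h x v w = bil h x w v

/-- Smoothness of a field of bilinear forms, read in the charts. -/
def SmoothForms (h : ∀ x : M, TangentSpace 𝓘(ℝ, E) x →L[ℝ] TangentSpace 𝓘(ℝ, E) x →L[ℝ] ℝ) :
    Prop :=
  ∀ p : M, ContDiffAt ℝ ∞ (pullbackForm h (extChartAt 𝓘(ℝ, E) p).symm) (extChartAt 𝓘(ℝ, E) p p)

variable [IsManifold 𝓘(ℝ, E) ∞ M]

theorem contMDiffAt_chart_symm {p : M} {z : E} (hz : z ∈ (extChartAt 𝓘(ℝ, E) p).target) :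
    ContMDiffAt 𝓘(ℝ, E) 𝓘(ℝ, E) ∞ (extChartAt 𝓘(ℝ, E) p).symm z :=
  ((contMDiffOn_extChartAt_symm p) z hz).contMDiffAt ((isOpen_extChartAt_target p).mem_nhds hz)

/-- The inverse of the tangent trivialization at `p` is the differential of the inverse chart. Hence
the bundle coordinates of the section `form` are its pullback by the inverse chart, and smoothness
of the section is smoothness of that pullback. -/
theorem PseudoRiemannianMetric.smoothForms (g : PseudoRiemannianMetric E M) :
    SmoothForms g.form := by
  intro p
  have h1 := (Bundle.contMDiffAt_section (F := E →L[ℝ] E →L[ℝ] ℝ) (IB := 𝓘(ℝ, E)) (n := ∞)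
    (s := fun x ↦ g.form x) p).1 (g.contMDiff p)
  have hz := mem_extChartAt_target (I := 𝓘(ℝ, E)) p
  have hp : (extChartAt 𝓘(ℝ, E) p).symm (extChartAt 𝓘(ℝ, E) p p) = p := extChartAt_to_inv p
  have h2 := ContMDiffAt.comp (extChartAt 𝓘(ℝ, E) p p) (by rw [hp]; exact h1)
    (contMDiffAt_chart_symm hz)
  refine h2.contDiffAt.congr_of_eventuallyEq ?_
  filter_upwards [(isOpen_extChartAt_target p).mem_nhds hz] with z hz
  have : IsManifold 𝓘(ℝ, E) 1 M := IsManifold.of_le (n := ∞) (by simp)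
  have hx : (extChartAt 𝓘(ℝ, E) p).symm z ∈ (chartAt E p).source := by
    have := (extChartAt 𝓘(ℝ, E) p).map_target hz
    rwa [extChartAt_source] at this
  have h3 := TangentBundle.symmL_trivializationAt (I := 𝓘(ℝ, E)) hx
  rw [(extChartAt 𝓘(ℝ, E) p).right_inv hz, modelWithCornersSelf_coe, range_id,
    mfderivWithin_univ] at h3
  have hb : (extChartAt 𝓘(ℝ, E) p).symm z ∈
      (trivializationAt E (TangentSpace 𝓘(ℝ, E)) p).baseSet := by
    rwa [TangentBundle.trivializationAt_baseSet]
  rw [Function.comp_apply]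
  ext v w
  have hsymm : ∀ a : E, (trivializationAt E (TangentSpace 𝓘(ℝ, E)) p).symm
      ((extChartAt 𝓘(ℝ, E) p).symm z) a = (tder (extChartAt 𝓘(ℝ, E) p).symm z : E →L[ℝ] E) a :=
    fun a ↦ (Bundle.Trivialization.symmL_apply (R := ℝ) _ hb a).symm.trans
      (congrArg (fun L : E →L[ℝ] E ↦ L a) h3)
  have e := inCoordinates_apply_eq₂ (F₁ := E) (F₂ := E) (F₃ := ℝ)
    (E₁ := fun x : M ↦ TangentSpace 𝓘(ℝ, E) x) (E₂ := fun x : M ↦ TangentSpace 𝓘(ℝ, E) x)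
    (E₃ := fun _ : M ↦ ℝ) (x₀ := p) (ϕ := g.form ((extChartAt 𝓘(ℝ, E) p).symm z))
    (v := v) (w := w) hb hb (mem_univ _)
  refine Eq.trans ?_ e.symm
  rw [hsymm, hsymm, pullbackForm_apply]
  simp
  rfl

theorem smoothForms_conformal (g : PseudoRiemannianMetric E M) {f : M → ℝ}
    (hf : ContMDiff 𝓘(ℝ, E) 𝓘(ℝ, ℝ) ∞ f) (hpos : ∀ x, 0 < f x) (β : ℝ) :
    SmoothForms (conformal g f β) := by
  intro p
  have h2 : ContDiffAt ℝ ∞ (fun y ↦ f ((extChartAt 𝓘(ℝ, E) p).symm y) ^ β)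
      (extChartAt 𝓘(ℝ, E) p p) := by
    refine ContDiffAt.rpow_const_of_ne ?_ (hpos _).ne'
    exact (hf.contMDiffAt.comp _ (contMDiffAt_chart_symm (mem_extChartAt_target p))).contDiffAt
  have heq : pullbackForm (conformal g f β) (extChartAt 𝓘(ℝ, E) p).symm = fun y ↦
      f ((extChartAt 𝓘(ℝ, E) p).symm y) ^ β •
        pullbackForm g.form (extChartAt 𝓘(ℝ, E) p).symm y := by
    ext y v w
    rfl
  rw [heq]
  exact h2.smul (g.smoothForms p)

theorem bil_conformal (g : PseudoRiemannianMetric E M) (f : M → ℝ) (β : ℝ) (x : M) (v w : E) :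
    bil (conformal g f β) x v w = f x ^ β * bil g.form x v w :=
  rfl

theorem PseudoRiemannianMetric.symmForms (g : PseudoRiemannianMetric E M) : SymmForms g.form :=
  g.symm

theorem symmForms_conformal (g : PseudoRiemannianMetric E M) (f : M → ℝ) (β : ℝ) :
    SymmForms (conformal g f β) := by
  intro x v w
  rw [bil_conformal, bil_conformal, g.symmForms]

/-- The expression of a smooth map in a chart. -/
theorem contDiffAt_extChartAt_comp {n : ℕ∞ω} (hn : n ≤ ∞) {φ : F → M} {u : F} {p : M}
    (hφ : ContMDiffAt 𝓘(ℝ, F) 𝓘(ℝ, E) n φ u) (hp : φ u ∈ (chartAt E p).source) :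
    ContDiffAt ℝ n (fun y ↦ extChartAt 𝓘(ℝ, E) p (φ y)) u :=
  (((contMDiffAt_extChartAt' (n := ∞) hp).of_le hn).comp u hφ).contDiffAt

theorem tder_eq_comp_extChartAt {φ : F → M} {u : F} {p : M}
    (hφ : MDifferentiableAt 𝓘(ℝ, F) 𝓘(ℝ, E) φ u) (hp : φ u ∈ (chartAt E p).source) (v : F) :
    (tder φ u : F →L[ℝ] E) v =
      (tder (extChartAt 𝓘(ℝ, E) p).symm (extChartAt 𝓘(ℝ, E) p (φ u)) : E →L[ℝ] E)
        (fderiv ℝ (fun y ↦ extChartAt 𝓘(ℝ, E) p (φ y)) u v) := by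
  have : IsManifold 𝓘(ℝ, E) 1 M := IsManifold.of_le (n := ∞) (by simp)
  have hp' : φ u ∈ (extChartAt 𝓘(ℝ, E) p).source := by rwa [extChartAt_source]
  have hz := (extChartAt 𝓘(ℝ, E) p).map_source hp'
  have hc : MDifferentiableAt 𝓘(ℝ, F) 𝓘(ℝ, E) (fun y ↦ extChartAt 𝓘(ℝ, E) p (φ y)) u :=
    (mdifferentiableAt_extChartAt hp).comp u hφ
  have heq : φ =ᶠ[𝓝 u] fun y ↦ (extChartAt 𝓘(ℝ, E) p).symm (extChartAt 𝓘(ℝ, E) p (φ y)) := by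
    filter_upwards [hφ.continuousAt.preimage_mem_nhds
      ((isOpen_extChartAt_source p).mem_nhds hp')] with y hy
    exact ((extChartAt 𝓘(ℝ, E) p).left_inv hy).symm
  rw [tder_congr heq, tder_comp (φ := (extChartAt 𝓘(ℝ, E) p).symm)
    (ψ := fun y ↦ extChartAt 𝓘(ℝ, E) p (φ y)) ((contMDiffAt_chart_symm hz).mdifferentiableAt (by simp)) hc,
    tder_eq_fderiv]

/-- Near `u` the map `φ` factors through the chart at `p`. This turns a pullback from `M` into a
pullback along a map of normed spaces, the situation of `geodesicDefect_pullback`. -/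
theorem pullbackForm_eventuallyEq
    (h : ∀ x : M, TangentSpace 𝓘(ℝ, E) x →L[ℝ] TangentSpace 𝓘(ℝ, E) x →L[ℝ] ℝ)
    {n : ℕ∞ω} (hn : 1 ≤ n) {φ : F → M} {u : F} {p : M}
    (hφ : ContMDiffAt 𝓘(ℝ, F) 𝓘(ℝ, E) n φ u) (hp : φ u ∈ (chartAt E p).source) :
    pullbackForm h φ =ᶠ[𝓝 u] fun y ↦
      (pullbackForm h (extChartAt 𝓘(ℝ, E) p).symm (extChartAt 𝓘(ℝ, E) p (φ y))).bilinearComp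
        (fderiv ℝ (fun y ↦ extChartAt 𝓘(ℝ, E) p (φ y)) y)
        (fderiv ℝ (fun y ↦ extChartAt 𝓘(ℝ, E) p (φ y)) y) := by
  filter_upwards [eventually_mdifferentiableAt hn hφ, hφ.continuousAt.preimage_mem_nhds
      ((chartAt E p).open_source.mem_nhds hp)] with y hy hy'
  have hp' : φ y ∈ (extChartAt 𝓘(ℝ, E) p).source := by rwa [extChartAt_source]
  ext v w
  rw [pullbackForm_apply, tder_eq_comp_extChartAt hy hy', tder_eq_comp_extChartAt hy hy',
    ContinuousLinearMap.bilinearComp_apply, pullbackForm_apply,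
    (extChartAt 𝓘(ℝ, E) p).left_inv hp']

variable {h : ∀ x : M, TangentSpace 𝓘(ℝ, E) x →L[ℝ] TangentSpace 𝓘(ℝ, E) x →L[ℝ] ℝ}

theorem SmoothForms.contDiffAt_pullbackForm (hh : SmoothForms h) {m n : ℕ∞ω} (hn : n ≤ ∞)
    (hmn : m + 1 ≤ n) {φ : F → M} {u : F} (hφ : ContMDiffAt 𝓘(ℝ, F) 𝓘(ℝ, E) n φ u) :
    ContDiffAt ℝ m (pullbackForm h φ) u := by
  have hp := mem_chart_source E (φ u)
  have h1n : 1 ≤ n := le_trans (by simp) hmn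
  have hmn' : m ≤ n := le_trans (by simp) hmn
  refine ContDiffAt.congr_of_eventuallyEq ?_ (pullbackForm_eventuallyEq h h1n hφ hp)
  have hc := contDiffAt_extChartAt_comp hn hφ hp
  have h1 : ContDiffAt ℝ m (fun y ↦ pullbackForm h (extChartAt 𝓘(ℝ, E) (φ u)).symm
      (extChartAt 𝓘(ℝ, E) (φ u) (φ y))) u :=
    ContDiffAt.comp (g := pullbackForm h (extChartAt 𝓘(ℝ, E) (φ u)).symm) u
      ((hh (φ u)).of_le (hmn'.trans hn)) (hc.of_le hmn')
  exact contDiffAt_bilinearComp h1 (hc.fderiv_right hmn)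

/-- The geodesic defect of a curve `φ ∘ u` computed in a chart and in the parametrization `φ`. -/
theorem geodesicDefect_pullbackForm (hh : SmoothForms h) (hs : SymmForms h) {φ : F → M} {u : ℝ → F}
    {γ : ℝ → M} {t : ℝ} {p : M} (hφ : ContMDiffAt 𝓘(ℝ, F) 𝓘(ℝ, E) 2 φ (u t))
    (hu : ContDiffAt ℝ 2 u t) (hγ : γ =ᶠ[𝓝 t] fun s ↦ φ (u s)) (hp : γ t ∈ (chartAt E p).source)
    (w : F) :
    geodesicDefect (pullbackForm h φ) u t w =
      geodesicDefect (pullbackForm h (extChartAt 𝓘(ℝ, E) p).symm)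
        (fun s ↦ extChartAt 𝓘(ℝ, E) p (γ s)) t
        (fderiv ℝ (fun y ↦ extChartAt 𝓘(ℝ, E) p (φ y)) (u t) w) := by
  rw [hγ.eq_of_nhds] at hp
  have hc := contDiffAt_extChartAt_comp (WithTop.coe_le_coe.2 le_top) hφ hp
  have hz := (extChartAt 𝓘(ℝ, E) p).map_source (by rwa [extChartAt_source])
  have h1 : ContDiffAt ℝ 1 (pullbackForm h (extChartAt 𝓘(ℝ, E) p).symm)
      (extChartAt 𝓘(ℝ, E) p (φ (u t))) :=
    hh.contDiffAt_pullbackForm (n := ∞) le_rfl (WithTop.coe_le_coe.2 le_top)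
      (contMDiffAt_chart_symm hz)
  have h2 : ∀ a b, pullbackForm h (extChartAt 𝓘(ℝ, E) p).symm (extChartAt 𝓘(ℝ, E) p (φ (u t))) a b =
      pullbackForm h (extChartAt 𝓘(ℝ, E) p).symm (extChartAt 𝓘(ℝ, E) p (φ (u t))) b a := by
    intro a b
    rw [pullbackForm_apply, pullbackForm_apply, hs]
  have h3 := geodesicDefect_congr (EventuallyEq.refl (𝓝 t) u)
    (pullbackForm_eventuallyEq h (by norm_num) hφ hp) w
  rw [h3]
  refine (geodesicDefect_pullback (Φ := fun y ↦ extChartAt 𝓘(ℝ, E) p (φ y)) h1 h2 hc hu w).trans ?_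
  refine geodesicDefect_congr ?_ (EventuallyEq.refl _ _) _
  filter_upwards [hγ] with s hs
  rw [hs]

theorem surjective_fderiv_extChartAt_comp {φ : F → M} {u : F} {p : M}
    (hφ : MDifferentiableAt 𝓘(ℝ, F) 𝓘(ℝ, E) φ u) (hp : φ u ∈ (chartAt E p).source)
    (hsurj : Function.Surjective (tder φ u : F →L[ℝ] E)) :
    Function.Surjective (fderiv ℝ (fun y ↦ extChartAt 𝓘(ℝ, E) p (φ y)) u) := by
  have : IsManifold 𝓘(ℝ, E) 1 M := IsManifold.of_le (n := ∞) (by simp)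
  have hinv := isInvertible_mfderiv_extChartAt (I := 𝓘(ℝ, E)) (x := p) (y := φ u)
    (by rwa [extChartAt_source])
  have hs : Function.Surjective (tder (extChartAt 𝓘(ℝ, E) p) (φ u) : E →L[ℝ] E) :=
    hinv.bijective.surjective
  intro w
  obtain ⟨v', hv'⟩ := hs w
  obtain ⟨v, hv⟩ := hsurj v'
  refine ⟨v, ?_⟩
  rw [← tder_eq_fderiv, tder_comp (mdifferentiableAt_extChartAt hp) hφ, hv, hv']

/-- The geodesic equation in a chart and in a submersive parametrization. -/
theorem geodesicEqAt_chart_iff (hh : SmoothForms h) (hs : SymmForms h) {φ : F → M} {u : ℝ → F}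
    {γ : ℝ → M} {t : ℝ} {p : M} (hφ : ContMDiffAt 𝓘(ℝ, F) 𝓘(ℝ, E) 2 φ (u t))
    (hu : ContDiffAt ℝ 2 u t) (hγ : γ =ᶠ[𝓝 t] fun s ↦ φ (u s)) (hp : γ t ∈ (chartAt E p).source)
    (hsurj : Function.Surjective (tder φ (u t) : F →L[ℝ] E)) :
    GeodesicEqAt (pullbackForm h (extChartAt 𝓘(ℝ, E) p).symm)
        (fun s ↦ extChartAt 𝓘(ℝ, E) p (γ s)) t ↔ GeodesicEqAt (pullbackForm h φ) u t := by
  have hp' := hp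
  rw [hγ.eq_of_nhds] at hp'
  have := surjective_fderiv_extChartAt_comp (hφ.mdifferentiableAt (by norm_num)) hp' hsurj
  simp only [geodesicEqAt_iff_geodesicDefect, geodesicDefect_pullbackForm hh hs hφ hu hγ hp]
  exact ⟨fun h w ↦ h _, fun h w ↦ by obtain ⟨v, rfl⟩ := this w; exact h v⟩

/-- The energy of a curve. -/
def energy (h : ∀ x : M, TangentSpace 𝓘(ℝ, E) x →L[ℝ] TangentSpace 𝓘(ℝ, E) x →L[ℝ] ℝ)
    (γ : ℝ → M) (t : ℝ) : ℝ :=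
  bil h (γ t) (vel E γ t) (vel E γ t)

omit [IsManifold 𝓘(ℝ, E) ∞ M] in
theorem energy_eq_pullbackForm {φ : F → M} {u : ℝ → F} {γ : ℝ → M} {t : ℝ}
    (hφ : MDifferentiableAt 𝓘(ℝ, F) 𝓘(ℝ, E) φ (u t)) (hu : DifferentiableAt ℝ u t)
    (hγ : γ =ᶠ[𝓝 t] fun s ↦ φ (u s)) :
    energy h γ t = pullbackForm h φ (u t) (deriv u t) (deriv u t) := by
  rw [energy, vel_congr hγ, vel_comp hφ hu.mdifferentiableAt, hγ.eq_of_nhds, vel_eq_deriv,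
    pullbackForm_apply]

/-- The energy of a geodesic is conserved. -/
theorem hasDerivAt_energy_of_geodesic (hh : SmoothForms h) (hs : SymmForms h)
    {φ : F → M} {u : ℝ → F} {γ : ℝ → M} {t : ℝ} (hφ : ContMDiffAt 𝓘(ℝ, F) 𝓘(ℝ, E) 2 φ (u t))
    (hu : ContDiffAt ℝ 2 u t) (hγ : γ =ᶠ[𝓝 t] fun s ↦ φ (u s))
    (hg : GeodesicEqAt (pullbackForm h φ) u t) : HasDerivAt (energy h γ) 0 t := by
  have h1 := hasDerivAt_energy (hh.contDiffAt_pullbackForm (m := 1)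
    (WithTop.coe_le_coe.2 le_top) (by norm_num) hφ) (fun a b ↦ hs _ _ _) hu
  rw [geodesicEqAt_iff_geodesicDefect.1 hg, mul_zero] at h1
  refine h1.congr_of_eventuallyEq ?_
  filter_upwards [hγ.eventuallyEq_nhds, eventually_differentiableAt hu (by norm_num),
    hu.continuousAt.eventually (eventually_mdifferentiableAt (by norm_num) hφ)] with s h1 h2 h3
  exact energy_eq_pullbackForm h3 h2 h1

end Manifold

/-! ### The action, its generator, and the metric in polar coordinates -/

section Action

variable {E : Type*} [NormedAddCommGroup E] [NormedSpace ℝ E]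
  {M : Type*} [TopologicalSpace M] [ChartedSpace E M]
  {F : Type*} [NormedAddCommGroup F] [NormedSpace ℝ F]
  {E' : Type*} [NormedAddCommGroup E'] [NormedSpace ℝ E']
  {M' : Type*} [TopologicalSpace M'] [ChartedSpace E' M']
  {m : ℝ → M → M}

theorem IsFreePosAction.act_inv (hm : IsFreePosAction E m) {a : ℝ} (ha : 0 < a) (x : M) :
    m a⁻¹ (m a x) = x := by
  rw [← hm.mul_act _ _ (inv_pos.2 ha) ha, inv_mul_cancel₀ ha.ne', hm.one_act]

theorem IsFreePosAction.inv_act (hm : IsFreePosAction E m) {a : ℝ} (ha : 0 < a) (x : M) :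
    m a (m a⁻¹ x) = x := by
  rw [← hm.mul_act _ _ ha (inv_pos.2 ha), mul_inv_cancel₀ ha.ne', hm.one_act]

theorem IsFreePosAction.exp_add (hm : IsFreePosAction E m) (s r : ℝ) (x : M) :
    m (Real.exp (s + r)) x = m (Real.exp s) (m (Real.exp r) x) := by
  rw [Real.exp_add, hm.mul_act _ _ (Real.exp_pos _) (Real.exp_pos _)]

theorem IsFreePosAction.exp_act_neg (hm : IsFreePosAction E m) (s : ℝ) (x : M) :
    m (Real.exp s) (m (Real.exp (-s)) x) = x := by
  rw [← hm.exp_add, add_neg_cancel, Real.exp_zero, hm.one_act]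

theorem IsFreePosAction.contMDiffAt_comp (hm : IsFreePosAction E m) {n : ℕ∞ω} (hn : n ≤ ∞)
    {c : M' → ℝ} {φ : M' → M} {y : M'} (hc : ContMDiffAt 𝓘(ℝ, E') 𝓘(ℝ, ℝ) n c y)
    (hpos : 0 < c y) (hφ : ContMDiffAt 𝓘(ℝ, E') 𝓘(ℝ, E) n φ y) :
    ContMDiffAt 𝓘(ℝ, E') 𝓘(ℝ, E) n (fun z ↦ m (c z) (φ z)) y := by
  have h1 : ContMDiffAt (𝓘(ℝ, ℝ).prod 𝓘(ℝ, E)) 𝓘(ℝ, E) ∞ (fun p : ℝ × M ↦ m p.1 p.2)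
      (c y, φ y) :=
    (hm.smooth (c y, φ y) ⟨hpos, mem_univ _⟩).contMDiffAt
      ((isOpen_Ioi.prod isOpen_univ).mem_nhds ⟨hpos, mem_univ _⟩)
  exact ContMDiffAt.comp y (h1.of_le hn) (hc.prodMk hφ)

theorem IsFreePosAction.contMDiffAt_exp_comp (hm : IsFreePosAction E m) {n : ℕ∞ω} (hn : n ≤ ∞)
    {c : M' → ℝ} {φ : M' → M} {y : M'} (hc : ContMDiffAt 𝓘(ℝ, E') 𝓘(ℝ, ℝ) n c y)
    (hφ : ContMDiffAt 𝓘(ℝ, E') 𝓘(ℝ, E) n φ y) :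
    ContMDiffAt 𝓘(ℝ, E') 𝓘(ℝ, E) n (fun z ↦ m (Real.exp (c z)) (φ z)) y :=
  hm.contMDiffAt_comp hn (Real.contDiff_exp.contMDiff.contMDiffAt.comp y hc) (Real.exp_pos _) hφ

theorem IsFreePosAction.mdifferentiableAt_act (hm : IsFreePosAction E m) {a : ℝ} (ha : 0 < a)
    (x : M) : MDifferentiableAt 𝓘(ℝ, E) 𝓘(ℝ, E) (m a) x :=
  (hm.contMDiffAt_comp (n := 1) (WithTop.coe_le_coe.2 le_top) contMDiffAt_const ha
    contMDiffAt_id).mdifferentiableAt one_ne_zero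

/-- The generating vector field, as an element of the model space. -/
def gen (E : Type*) [NormedAddCommGroup E] [NormedSpace ℝ E]
    {M : Type*} [TopologicalSpace M] [ChartedSpace E M] (m : ℝ → M → M) (x : M) : E :=
  generator E m x

theorem gen_eq_vel (m : ℝ → M → M) (x : M) :
    gen E m x = vel E (fun t : ℝ ↦ m (Real.exp t) x) 0 := by
  rfl

theorem IsFreePosAction.tder_act_surjective (hm : IsFreePosAction E m) {a : ℝ} (ha : 0 < a)
    (x : M) : Function.Surjective (tder (m a) x : E →L[ℝ] E) := by
  intro w
  refine ⟨(tder (m a⁻¹) (m a x) : E →L[ℝ] E) w, ?_⟩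
  have h1 := tder_comp (φ := m a) (ψ := m a⁻¹) (x := m a x)
    (hm.mdifferentiableAt_act ha _) (hm.mdifferentiableAt_act (inv_pos.2 ha) _) w
  rw [hm.act_inv ha] at h1
  rw [← h1]
  simp only [hm.inv_act ha]
  exact tder_id _ _

/-- The differential of `(s, v) ↦ m (e^s) (φ v)`. -/
theorem IsFreePosAction.tder_exp_act (hm : IsFreePosAction E m) {φ : F → M} {v : F}
    {s : ℝ} (hφ : MDifferentiableAt 𝓘(ℝ, F) 𝓘(ℝ, E) φ v)
    (hΨ : MDifferentiableAt 𝓘(ℝ, ℝ × F) 𝓘(ℝ, E) (fun z : ℝ × F ↦ m (Real.exp z.1) (φ z.2)) (s, v))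
    (a : ℝ) (w : F) :
    (tder (fun z : ℝ × F ↦ m (Real.exp z.1) (φ z.2)) (s, v) : ℝ × F →L[ℝ] E) (a, w) =
      (tder (m (Real.exp s)) (φ v) : E →L[ℝ] E)
        (a • gen E m (φ v) + (tder φ v : F →L[ℝ] E) w) := by
  have hact := hm.mdifferentiableAt_act (Real.exp_pos s) (φ v)
  have h2 : (tder (fun z : ℝ × F ↦ m (Real.exp z.1) (φ z.2)) (s, v) : ℝ × F →L[ℝ] E) (0, w) =
      (tder (m (Real.exp s)) (φ v) : E →L[ℝ] E) ((tder φ v : F →L[ℝ] E) w) := by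
    rw [← tder_comp hact hφ]
    have hd : HasFDerivAt (fun y : F ↦ (s, y)) (ContinuousLinearMap.inr ℝ ℝ F) v :=
      hasFDerivAt_prodMk_right s v
    have := tder_comp (φ := fun z : ℝ × F ↦ m (Real.exp z.1) (φ z.2)) (ψ := fun y : F ↦ (s, y))
      (x := v) hΨ hd.differentiableAt.mdifferentiableAt w
    rw [this, tder_eq_fderiv, hd.fderiv]
    rfl
  -- By the group law, `m (e^{s + r}) = m (e^s) ∘ m (e^r)`; differentiating in `r` at `0` produces
  -- the generator at `φ v`, pushed forward by `m (e^s)`.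
  have h1 : (tder (fun z : ℝ × F ↦ m (Real.exp z.1) (φ z.2)) (s, v) : ℝ × F →L[ℝ] E) (1, 0) =
      (tder (m (Real.exp s)) (φ v) : E →L[ℝ] E) (gen E m (φ v)) := by
    have hc : MDifferentiableAt 𝓘(ℝ, ℝ) 𝓘(ℝ, E) (fun t : ℝ ↦ m (Real.exp t) (φ v)) 0 :=
      (hm.contMDiffAt_exp_comp (n := 1) (WithTop.coe_le_coe.2 le_top) contMDiffAt_id
        contMDiffAt_const).mdifferentiableAt one_ne_zero
    have hact' : MDifferentiableAt 𝓘(ℝ, E) 𝓘(ℝ, E) (m (Real.exp s)) (m (Real.exp 0) (φ v)) :=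
      hm.mdifferentiableAt_act (Real.exp_pos s) _
    have e1 := vel_comp (φ := m (Real.exp s)) (u := fun t : ℝ ↦ m (Real.exp t) (φ v)) (t := 0)
      hact' hc
    rw [Real.exp_zero, hm.one_act] at e1
    rw [gen_eq_vel, ← e1]
    simp only [← hm.exp_add]
    have hd : HasDerivAt (fun r : ℝ ↦ (s + r, v)) ((1 : ℝ), (0 : F)) 0 :=
      ((hasDerivAt_id (0 : ℝ)).const_add s).prodMk (hasDerivAt_const 0 v)
    have e2 := vel_comp (φ := fun z : ℝ × F ↦ m (Real.exp z.1) (φ z.2))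
      (u := fun r : ℝ ↦ (s + r, v)) (t := 0) (by simpa using hΨ)
      hd.differentiableAt.mdifferentiableAt
    rw [vel_eq_deriv, hd.deriv, add_zero] at e2
    exact e2.symm
  have hsplit : ((a, w) : ℝ × F) = a • ((1 : ℝ), (0 : F)) + ((0 : ℝ), w) := by simp
  rw [hsplit, map_add, map_smul, h1, h2, map_add, map_smul]

/-- The velocity of `t ↦ m (e^{s t}) (c t)`. -/
theorem IsFreePosAction.vel_exp_act (hm : IsFreePosAction E m) {s : ℝ → ℝ} {c : ℝ → M} {t : ℝ}
    (hs : DifferentiableAt ℝ s t) (hc : ContMDiffAt 𝓘(ℝ, ℝ) 𝓘(ℝ, E) 1 c t) :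
    vel E (fun r ↦ m (Real.exp (s r)) (c r)) t =
      (tder (m (Real.exp (s t))) (c t) : E →L[ℝ] E) (deriv s t • gen E m (c t) + vel E c t) := by
  -- The curve `c` itself serves as the parametrization, with parameter space `ℝ`, followed along `r
  -- ↦ (s r, r)`.
  have hΨ : MDifferentiableAt 𝓘(ℝ, ℝ × ℝ) 𝓘(ℝ, E) (fun z : ℝ × ℝ ↦ m (Real.exp z.1) (c z.2))
      (s t, t) :=
    (hm.contMDiffAt_exp_comp (n := 1) (WithTop.coe_le_coe.2 le_top)
      contDiff_fst.contMDiff.contMDiffAt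
      (ContMDiffAt.comp (s t, t) (g := c) (f := Prod.snd) hc
        contDiff_snd.contMDiff.contMDiffAt)).mdifferentiableAt one_ne_zero
  have hd : HasDerivAt (fun r : ℝ ↦ (s r, r)) (deriv s t, (1 : ℝ)) t :=
    hs.hasDerivAt.prodMk (hasDerivAt_id t)
  have e2 := vel_comp (φ := fun z : ℝ × ℝ ↦ m (Real.exp z.1) (c z.2))
      (u := fun r : ℝ ↦ (s r, r)) (t := t) hΨ hd.differentiableAt.mdifferentiableAt
  rw [vel_eq_deriv, hd.deriv, hm.tder_exp_act (hc.mdifferentiableAt one_ne_zero) hΨ] at e2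
  exact e2

variable [IsManifold 𝓘(ℝ, E) ∞ M] {g : PseudoRiemannianMetric E M} {f : M → ℝ} {α : ℝ}

theorem IsHomogeneousPair.mdifferentiableAt (hgf : IsHomogeneousPair m g f α) (x : M) :
    MDifferentiableAt 𝓘(ℝ, E) 𝓘(ℝ, ℝ) f x :=
  hgf.smooth.contMDiffAt.mdifferentiableAt (by simp)

theorem IsHomogeneousPair.bil_gen (hgf : IsHomogeneousPair m g f α) (x : M) (v : E) :
    bil g.form x (gen E m x) v = (tder f x : E →L[ℝ] ℝ) v :=
  hgf.generator_dual x v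

theorem IsHomogeneousPair.apply_exp (hgf : IsHomogeneousPair m g f α) (s : ℝ) (x : M) :
    f (m (Real.exp s) x) = Real.exp (α * s) * f x := by
  rw [hgf.fun_homog _ (Real.exp_pos s), ← Real.exp_mul, mul_comm s]

/-- Euler's relation: differentiate `f (m (e^t) x) = e^{α t} f x` at `t = 0`. Since `α f` never
vanishes, `P` is transverse to the level sets, and `g(P, P) = α f`. -/
theorem IsHomogeneousPair.tder_gen (hm : IsFreePosAction E m) (hgf : IsHomogeneousPair m g f α)
    (x : M) : (tder f x : E →L[ℝ] ℝ) (gen E m x) = α * f x := by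
  have hc : MDifferentiableAt 𝓘(ℝ, ℝ) 𝓘(ℝ, E) (fun t : ℝ ↦ m (Real.exp t) x) 0 :=
    (hm.contMDiffAt_exp_comp (n := 1) (WithTop.coe_le_coe.2 le_top) contMDiffAt_id
      contMDiffAt_const).mdifferentiableAt one_ne_zero
  have e1 := vel_comp (φ := f) (u := fun t : ℝ ↦ m (Real.exp t) x) (t := 0)
    (hgf.mdifferentiableAt _) hc
  rw [← gen_eq_vel, Real.exp_zero, hm.one_act] at e1
  rw [← e1, vel_eq_deriv]
  simp only [hgf.apply_exp]
  have : HasDerivAt (fun s ↦ Real.exp (α * s) * f x) (Real.exp (α * 0) * (α * 1) * f x) 0 :=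
    (((hasDerivAt_id (0 : ℝ)).const_mul α).exp).mul_const _
  rw [this.deriv]
  simp

theorem IsHomogeneousPair.bil_act (hgf : IsHomogeneousPair m g f α) (s : ℝ) (x : M) (v w : E) :
    bil g.form (m (Real.exp s) x) ((tder (m (Real.exp s)) x : E →L[ℝ] E) v)
      ((tder (m (Real.exp s)) x : E →L[ℝ] E) w) = Real.exp (α * s) * bil g.form x v w := by
  have := hgf.metric_homog _ (Real.exp_pos s) x v w
  rw [← Real.exp_mul, mul_comm s] at this
  exact this

/-- In the coordinates `(s, v) ↦ m (e^s) (φ v)`, the metric `f^β g` is a warped product. -/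
theorem IsHomogeneousPair.pullbackForm_conformal (hm : IsFreePosAction E m)
    (hgf : IsHomogeneousPair m g f α) {l : ℝ} (β : ℝ) {φ : F → M} {s : ℝ} {v : F}
    (hφ : MDifferentiableAt 𝓘(ℝ, F) 𝓘(ℝ, E) φ v)
    (hΨ : MDifferentiableAt 𝓘(ℝ, ℝ × F) 𝓘(ℝ, E) (fun z : ℝ × F ↦ m (Real.exp z.1) (φ z.2)) (s, v))
    (hl : ∀ᶠ y in 𝓝 v, f (φ y) = l) :
    pullbackForm (conformal g f β) (fun z : ℝ × F ↦ m (Real.exp z.1) (φ z.2)) (s, v) =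
      warpedForm (l ^ β) (α * (β + 1)) (α * l) (pullbackForm g.form φ) (s, v) := by
  have hlv := hl.self_of_nhds
  have hlpos : 0 < l := hlv ▸ hgf.pos (φ v)
  have hdf : ∀ w : F, (tder f (φ v) : E →L[ℝ] ℝ) ((tder φ v : F →L[ℝ] E) w) = 0 := by
    intro w
    rw [← tder_comp (hgf.mdifferentiableAt _) hφ,
      tder_congr (ψ := fun _ ↦ l) hl, tder_eq_fderiv]
    simp
  refine ContinuousLinearMap.ext fun ⟨a, w⟩ ↦ ContinuousLinearMap.ext fun ⟨a', w'⟩ ↦ ?_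
  rw [pullbackForm_apply, bil_conformal, hm.tder_exp_act hφ hΨ, hm.tder_exp_act hφ hΨ,
    hgf.bil_act, hgf.apply_exp, warpedForm_apply, pullbackForm_apply, hlv]
  -- The mixed terms vanish: `g(P, ·) = df` kills the vectors tangent to the level set.
  have h1 : bil g.form (φ v) ((tder φ v : F →L[ℝ] E) w) (gen E m (φ v)) = 0 := by
    rw [g.symmForms, hgf.bil_gen, hdf]
  simp only [map_add, map_smul, add_apply, smul_apply, smul_eq_mul, hgf.bil_gen, hdf, h1,
    hgf.tder_gen hm, hlv]
  -- The exponent `α (β + 1) s` collects `α β s` from `f^β` and `α s` from `g`.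
  rw [Real.mul_rpow (Real.exp_pos _).le hlpos.le, ← Real.exp_mul,
    show α * (β + 1) * s = α * s * β + α * s by ring, Real.exp_add]
  ring

end Action

/-! ### Local parametrizations of the level sets -/

section Parametrization

variable {E : Type*} [NormedAddCommGroup E] [NormedSpace ℝ E]
  {M : Type*} [TopologicalSpace M] [ChartedSpace E M]
  {F : Type*} [NormedAddCommGroup F] [NormedSpace ℝ F]

/-- A retract of a complete normed space is complete. -/
theorem completeSpace_of_leftInverse [CompleteSpace E] (D : F →L[ℝ] E) (L : E →L[ℝ] F)
    (h : ∀ v, L (D v) = v) : CompleteSpace F := by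
  refine Metric.complete_of_cauchySeq_tendsto fun u hu ↦ ?_
  obtain ⟨y, hy⟩ := cauchySeq_tendsto_of_complete (D.uniformContinuous.comp_cauchySeq hu)
  refine ⟨L y, ?_⟩
  have := (L.continuous.tendsto y).comp hy
  simpa [Function.comp_def, h] using this

theorem IsLocalParametrization.contMDiffAt {S : Set M} {φ : F → M} {U : Set F}
    (hφ : IsLocalParametrization E S φ U) {u : F} (hu : u ∈ U) :
    ContMDiffAt 𝓘(ℝ, F) 𝓘(ℝ, E) ∞ φ u :=
  (hφ.smooth u hu).contMDiffAt (hφ.isOpen.mem_nhds hu)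

variable [IsManifold 𝓘(ℝ, E) ∞ M]

/-- A local parametrization has a smooth local left inverse defined on the ambient manifold. -/
theorem IsLocalParametrization.exists_retraction [CompleteSpace E] {S : Set M} {φ : F → M}
    {U : Set F} (hφ : IsLocalParametrization E S φ U) {u₀ : F} (hu₀ : u₀ ∈ U) :
    ∃ π : M → F, ContMDiffAt 𝓘(ℝ, E) 𝓘(ℝ, F) ∞ π (φ u₀) ∧ (∀ᶠ u in 𝓝 u₀, π (φ u) = u) ∧
      ∀ᶠ x in 𝓝 (φ u₀), x ∈ S → φ (π x) = x := by
  have hsm := hφ.contMDiffAt hu₀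
  have hp := mem_chart_source E (φ u₀)
  obtain ⟨L, hL⟩ := hφ.immersion u₀ hu₀
  let L₁ : E →L[ℝ] F := L
  have hL₁ : ∀ v, L₁ ((tder φ u₀ : F →L[ℝ] E) v) = v := hL
  set e := extChartAt 𝓘(ℝ, E) (φ u₀) with he
  have hc : ContDiffAt ℝ ∞ (fun y ↦ e (φ y)) u₀ := contDiffAt_extChartAt_comp le_rfl hsm hp
  let D : F →L[ℝ] E := fderiv ℝ (fun y ↦ e (φ y)) u₀
  let L' : E →L[ℝ] F := L₁.comp (tder e.symm (e (φ u₀)) : E →L[ℝ] E)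
  have hL' : ∀ v, L' (D v) = v := by
    intro v
    change L₁ ((tder e.symm (e (φ u₀)) : E →L[ℝ] E) (D v)) = v
    rw [← tder_eq_comp_extChartAt (hsm.mdifferentiableAt (by simp)) hp, hL₁]
  have : CompleteSpace F := completeSpace_of_leftInverse D L' hL'
  -- In the chart, a linear left inverse of the differential of `φ` turns `φ` into a self-map `q` of
  -- `F` with derivative the identity at `u₀`. The inverse function theorem applies because `F`, a
  -- retract of `E`, is complete.
  let q : F → F := fun y ↦ L' (e (φ y))
  have hq : ContDiffAt ℝ ∞ q u₀ := L'.contDiff.contDiffAt.comp u₀ hc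
  have hq' : HasFDerivAt q ((ContinuousLinearEquiv.refl ℝ F : F ≃L[ℝ] F) : F →L[ℝ] F) u₀ := by
    have := L'.hasFDerivAt.comp u₀ (hc.differentiableAt (by simp)).hasFDerivAt
    refine this.congr_fderiv ?_
    ext v
    exact hL' v
  let R := hq.toOpenPartialHomeomorph q hq' (by simp)
  have hR : ∀ y, R y = q y := fun _ ↦ rfl
  have hsrc : u₀ ∈ R.source := hq.mem_toOpenPartialHomeomorph_source hq' (by simp)
  let π : M → F := fun x ↦ R.symm (L' (e x))
  have hleft : ∀ᶠ u in 𝓝 u₀, π (φ u) = u := by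
    filter_upwards [R.open_source.mem_nhds hsrc] with u hu
    exact R.left_inv hu
  refine ⟨π, ?_, hleft, ?_⟩
  · have h1 : ContDiffAt ℝ ∞ R.symm (L' (e (φ u₀))) := hq.to_localInverse hq' (by simp)
    have h2 : ContMDiffAt 𝓘(ℝ, E) 𝓘(ℝ, E) ∞ e (φ u₀) := contMDiffAt_extChartAt
    exact (h1.comp _ L'.contDiff.contDiffAt).contMDiffAt.comp (φ u₀) h2
  -- Since `φ` is open onto its image in `S`, points of `S` near `φ u₀` are images of parameters so
  -- close to `u₀` that `π` already inverts `φ` there.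
  · obtain ⟨W, hWsub, hWo, hW₀⟩ := mem_nhds_iff.1 hleft
    obtain ⟨hS, hemb⟩ := hφ.isOpenEmbedding
    have himg := hemb.isOpenMap (Subtype.val ⁻¹' W) (hWo.preimage continuous_subtype_val)
    obtain ⟨O, hO, hOeq⟩ := isOpen_induced_iff.1 himg
    have hmem : φ u₀ ∈ O := by
      have : (⟨φ u₀, hS hu₀⟩ : S) ∈ Subtype.val ⁻¹' O := by
        rw [hOeq]
        exact ⟨⟨u₀, hu₀⟩, hW₀, rfl⟩
      exact this
    filter_upwards [hO.mem_nhds hmem] with x hx hxS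
    have : (⟨x, hxS⟩ : S) ∈ Subtype.val ⁻¹' O := hx
    rw [hOeq] at this
    obtain ⟨⟨w, hwU⟩, hwW, hw⟩ := this
    have hw' : φ w = x := congrArg Subtype.val hw
    rw [← hw']
    exact congrArg φ (hWsub hwW)

/-- Every tangent vector is the velocity of a smooth curve. -/
theorem exists_curve (x : M) (w : E) : ∃ c : ℝ → M,
    ContMDiffAt 𝓘(ℝ, ℝ) 𝓘(ℝ, E) ∞ c 0 ∧ c 0 = x ∧ vel E c 0 = w := by
  set e := extChartAt 𝓘(ℝ, E) x with he
  have hz := mem_extChartAt_target (I := 𝓘(ℝ, E)) x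
  have hp := mem_chart_source E x
  have hxe : e.symm (e x) = x := extChartAt_to_inv x
  have : IsManifold 𝓘(ℝ, E) 1 M := IsManifold.of_le (n := ∞) (by simp)
  let w₀ : E := (tder e x : E →L[ℝ] E) w
  have hw₀ : (tder e.symm (e x) : E →L[ℝ] E) w₀ = w := by
    have h1 := tder_comp (φ := e.symm) (ψ := e) (x := x)
      ((contMDiffAt_chart_symm hz).mdifferentiableAt (by simp)) (mdifferentiableAt_extChartAt hp) w
    have h2 : (fun y ↦ e.symm (e y)) =ᶠ[𝓝 x] fun y ↦ y := by
      filter_upwards [extChartAt_source_mem_nhds (I := 𝓘(ℝ, E)) x] with y hy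
      exact e.left_inv hy
    rw [tder_congr h2, tder_id] at h1
    exact h1.symm
  have hlin : HasDerivAt (fun s : ℝ ↦ e x + s • w₀) w₀ 0 := by
    simpa using ((hasDerivAt_id (0 : ℝ)).smul_const w₀).const_add (e x)
  have h0 : e x + (0 : ℝ) • w₀ = e x := by simp
  have hs : ContMDiffAt 𝓘(ℝ, E) 𝓘(ℝ, E) ∞ e.symm (e x + (0 : ℝ) • w₀) := by
    rw [h0]; exact contMDiffAt_chart_symm hz
  refine ⟨fun s ↦ e.symm (e x + s • w₀), ?_, ?_, ?_⟩
  · have hl : ContDiff ℝ ∞ (fun s : ℝ ↦ e x + s • w₀) :=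
      contDiff_const.add (contDiff_id.smul contDiff_const)
    exact ContMDiffAt.comp (0 : ℝ) hs hl.contMDiff.contMDiffAt
  · change e.symm (e x + (0 : ℝ) • w₀) = x
    rw [h0, hxe]
  · have := vel_comp (φ := e.symm) (u := fun s : ℝ ↦ e x + s • w₀) (t := 0)
      (hs.mdifferentiableAt (by simp)) hlin.differentiableAt.mdifferentiableAt
    rw [this, vel_eq_deriv, hlin.deriv, h0, hw₀]

variable {m : ℝ → M → M} {g : PseudoRiemannianMetric E M} {f : M → ℝ} {α : ℝ}

/-- The tangent space of the level set, as given by a local parametrization. -/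
theorem IsLocalParametrization.mem_range_tder [CompleteSpace E] (hm : IsFreePosAction E m)
    (hgf : IsHomogeneousPair m g f α) {l : ℝ} {φ : F → M} {U : Set F}
    (hφ : IsLocalParametrization E (levelSet f l) φ U) {u₀ : F} (hu₀ : u₀ ∈ U) {w : E}
    (hw : (tder f (φ u₀) : E →L[ℝ] ℝ) w = 0) : ∃ v, (tder φ u₀ : F →L[ℝ] E) v = w := by
  obtain ⟨hS, -⟩ := hφ.isOpenEmbedding
  have hl : f (φ u₀) = l := hS hu₀
  have hlpos : 0 < l := hl ▸ hgf.pos _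
  obtain ⟨c, hc, hc0, hcv⟩ := exists_curve (φ u₀) w
  have hfc : ContDiffAt ℝ ∞ (fun s ↦ f (c s)) 0 := (hgf.smooth.contMDiffAt.comp 0 hc).contDiffAt
  have hfc' : HasDerivAt (fun s ↦ f (c s)) 0 0 := by
    have := vel_comp (φ := f) (u := c) (t := 0) (hgf.mdifferentiableAt _)
      (hc.mdifferentiableAt (by simp))
    rw [vel_eq_deriv, hcv, hc0, hw] at this
    exact (hfc.differentiableAt (by simp)).hasDerivAt.congr_deriv this
  -- Chosen so that `e^{α σ} f(c) = l`: the action pushes the curve back into the level set. As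
  -- `df(w) = 0`, the correction vanishes to first order and the velocity remains `w`; the
  -- retraction then lifts the corrected curve to `F`.
  let σ : ℝ → ℝ := fun s ↦ (Real.log l - Real.log (f (c s))) / α
  have hσ : ContDiffAt ℝ ∞ σ 0 := (contDiffAt_const.sub (hfc.log (hgf.pos _).ne')).div_const α
  have hσ0 : σ 0 = 0 := by simp [σ, hc0, hl]
  have hσ' : deriv σ 0 = 0 := by
    refine (((hfc'.log (hgf.pos _).ne').const_sub (Real.log l)).div_const α).deriv.trans ?_
    simp
  let b : ℝ → M := fun s ↦ m (Real.exp (σ s)) (c s)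
  have hb : ContMDiffAt 𝓘(ℝ, ℝ) 𝓘(ℝ, E) ∞ b 0 :=
    hm.contMDiffAt_exp_comp le_rfl hσ.contMDiffAt hc
  have hb0 : b 0 = φ u₀ := by simp only [b, hσ0, Real.exp_zero, hm.one_act, hc0]
  have hbS : ∀ s, b s ∈ levelSet f l := by
    intro s
    change f (m (Real.exp (σ s)) (c s)) = l
    rw [hgf.apply_exp, mul_div_cancel₀ _ hgf.degree_ne_zero, Real.exp_sub, Real.exp_log hlpos,
      Real.exp_log (hgf.pos _), div_mul_cancel₀ _ (hgf.pos _).ne']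
  have hbv : vel E b 0 = w := by
    have := hm.vel_exp_act (hσ.differentiableAt (by simp))
      (hc.of_le (WithTop.coe_le_coe.2 le_top))
    rw [hσ0, hσ', zero_smul, zero_add, hcv, Real.exp_zero] at this
    rw [this, show m 1 = fun x ↦ x from funext hm.one_act, tder_id]
  obtain ⟨π, hπ, hπφ, hφπ⟩ := hφ.exists_retraction hu₀
  have hπb : MDifferentiableAt 𝓘(ℝ, ℝ) 𝓘(ℝ, F) (fun s ↦ π (b s)) 0 :=
    MDifferentiableAt.comp (0 : ℝ) (g := π) (f := b)
      (by rw [hb0]; exact hπ.mdifferentiableAt (by simp)) (hb.mdifferentiableAt (by simp))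
  have hπ0 : π (b 0) = u₀ := by rw [hb0, hπφ.self_of_nhds]
  have heq : b =ᶠ[𝓝 0] fun s ↦ φ (π (b s)) := by
    filter_upwards [hb.continuousAt.eventually (by rw [hb0]; exact hφπ)] with s hs
    exact (hs (hbS s)).symm
  have hv := vel_comp (φ := φ) (u := fun s ↦ π (b s)) (t := 0)
    (by rw [hπ0]; exact (hφ.contMDiffAt hu₀).mdifferentiableAt (by simp)) hπb
  rw [← vel_congr heq, hbv, hπ0] at hv
  exact ⟨_, hv.symm⟩

/-- The level set has a local parametrization around each of its points. -/
theorem exists_isLocalParametrization [CompleteSpace E] (hm : IsFreePosAction E m)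
    (hgf : IsHomogeneousPair m g f α) {l : ℝ} {x : M} (hx : x ∈ levelSet f l) :
    ∃ (F : Submodule ℝ E) (φ : F → M) (U : Set F) (u₀ : F),
      IsLocalParametrization E (levelSet f l) φ U ∧ u₀ ∈ U ∧ φ u₀ = x := by
  have hx' : f x = l := hx
  have hlpos : 0 < l := hx' ▸ hgf.pos _
  have hM1 : IsManifold 𝓘(ℝ, E) 1 M := IsManifold.of_le (n := ∞) (by simp)
  set e := extChartAt 𝓘(ℝ, E) x with he
  have hz := mem_extChartAt_target (I := 𝓘(ℝ, E)) x
  have hxe : e.symm (e x) = x := extChartAt_to_inv x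
  let Θ : E → ℝ := fun z ↦ f (e.symm z)
  have hΘ : ∀ z ∈ e.target, ContDiffAt ℝ ∞ Θ z := fun z hz ↦
    (hgf.smooth.contMDiffAt.comp z (contMDiffAt_chart_symm hz)).contDiffAt
  let D : E →L[ℝ] ℝ := fderiv ℝ Θ (e x)
  -- A multiple of the generator, read in the chart: `df(P) = α l ≠ 0`. It spans a complement of
  -- `ker D`, so no splitting hypothesis is needed.
  obtain ⟨p, hp⟩ : ∃ p, D p = 1 := by
    have h1 : (tder f x : E →L[ℝ] ℝ) (gen E m x) = D ((tder e x : E →L[ℝ] E) (gen E m x)) := by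
      have h2 := tder_comp (φ := Θ) (ψ := e) (x := x)
        ((hΘ _ hz).differentiableAt (by simp)).mdifferentiableAt
        (mdifferentiableAt_extChartAt (mem_chart_source E x)) (gen E m x)
      rw [tder_eq_fderiv] at h2
      rw [← h2]
      refine congrArg (fun L : E →L[ℝ] ℝ ↦ L (gen E m x)) (tder_congr ?_)
      filter_upwards [extChartAt_source_mem_nhds (I := 𝓘(ℝ, E)) x] with y hy
      change f y = f (e.symm (e y))
      rw [e.left_inv hy]
    rw [hgf.tder_gen hm, hx'] at h1
    refine ⟨(α * l)⁻¹ • (tder e x : E →L[ℝ] E) (gen E m x), ?_⟩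
    rw [map_smul, ← h1, smul_eq_mul, inv_mul_cancel₀ (mul_ne_zero hgf.degree_ne_zero hlpos.ne')]
  let F : Submodule ℝ E := LinearMap.ker (D : E →ₗ[ℝ] ℝ)
  have hF : ∀ w : F, D w = 0 := fun w ↦ w.2
  let pr : E →L[ℝ] F := (ContinuousLinearMap.id ℝ E - D.smulRight p).codRestrict F (by
    intro z
    change D (z - D z • p) = 0
    rw [map_sub, map_smul, hp, smul_eq_mul, mul_one, sub_self])
  have hpr : ∀ z, (pr z : E) = z - D z • p := fun _ ↦ rfl
  let A : E ≃L[ℝ] ℝ × F := ContinuousLinearEquiv.equivOfInverse (D.prod pr)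
    ((ContinuousLinearMap.fst ℝ ℝ F).smulRight p +
      F.subtypeL.comp (ContinuousLinearMap.snd ℝ ℝ F))
    (fun z ↦ by
      change D z • p + (pr z : E) = z
      rw [hpr]; abel)
    (fun z ↦ by
      have h1 : D (z.1 • p + (z.2 : E)) = z.1 := by
        rw [map_add, map_smul, hp, hF, smul_eq_mul, mul_one, add_zero]
      refine Prod.ext h1 (Subtype.ext ?_)
      change (pr (z.1 • p + (z.2 : E)) : E) = z.2
      rw [hpr, h1, add_sub_cancel_left])
  -- Straightens the level sets of `f`: the first coordinate is `f` itself, and `φ` is the inverse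
  -- of `Λ` on the slice where that coordinate is `l`.
  let Λ : E → ℝ × F := fun z ↦ (Θ z, pr z)
  have hΛ : ∀ z ∈ e.target, ContDiffAt ℝ ∞ Λ z := fun z hz ↦
    (hΘ z hz).prodMk pr.contDiff.contDiffAt
  have hΛ' : HasFDerivAt Λ (A : E →L[ℝ] ℝ × F) (e x) :=
    (((hΘ _ hz).differentiableAt (by simp)).hasFDerivAt).prodMk pr.hasFDerivAt
  -- The local inverse must be smooth at every point of its domain, not only at the centre, so the
  -- domain is shrunk to where the derivative of `Λ` is invertible.
  have hev : ∀ᶠ z in 𝓝 (e x), z ∈ e.target ∧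
      ∃ A' : E ≃L[ℝ] ℝ × F, HasFDerivAt Λ (A' : E →L[ℝ] ℝ × F) z := by
    have hcont : ContinuousAt (fderiv ℝ Λ) (e x) :=
      ((hΛ _ hz).fderiv_right (m := 0) (by simp)).continuousAt
    have hA : range ((↑) : (E ≃L[ℝ] ℝ × F) → E →L[ℝ] ℝ × F) ∈ 𝓝 (fderiv ℝ Λ (e x)) := by
      rw [hΛ'.fderiv]; exact A.nhds
    filter_upwards [(isOpen_extChartAt_target x).mem_nhds hz, hcont.preimage_mem_nhds hA]
      with z hz ⟨A', hA'⟩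
    exact ⟨hz, A', hA' ▸ ((hΛ z hz).differentiableAt (by simp)).hasFDerivAt⟩
  obtain ⟨N, hNsub, hNo, hN₀⟩ := mem_nhds_iff.1 hev
  let R₀ := (hΛ _ hz).toOpenPartialHomeomorph Λ hΛ' (by simp)
  let R := R₀.restrOpen N hNo
  have hRapp : ∀ z, R z = Λ z := fun _ ↦ rfl
  have hRN : ∀ z ∈ R.source, z ∈ N := fun z hz ↦ by
    rw [OpenPartialHomeomorph.restrOpen_source] at hz
    exact hz.2
  have hsrc : e x ∈ R.source := by
    rw [OpenPartialHomeomorph.restrOpen_source]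
    exact ⟨(hΛ _ hz).mem_toOpenPartialHomeomorph_source hΛ' (by simp), hN₀⟩
  have hRsymm : ∀ y ∈ R.target, ContDiffAt ℝ ∞ R.symm y := fun y hy ↦ by
    obtain ⟨h1, A', hA'⟩ := hNsub (hRN _ (R.map_target hy))
    exact R.contDiffAt_symm hy hA' (hΛ _ h1)
  let U : Set F := {w | (l, w) ∈ R.target}
  have hUo : IsOpen U := R.open_target.preimage (by fun_prop)
  let φ : F → M := fun w ↦ e.symm (R.symm (l, w))
  have hφt : ∀ w ∈ U, R.symm (l, w) ∈ e.target := fun w hw ↦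
    (hNsub (hRN _ (R.map_target hw))).1
  have heφ : ∀ w ∈ U, e (φ w) = R.symm (l, w) := fun w hw ↦ e.right_inv (hφt w hw)
  have hΛφ : ∀ w ∈ U, Λ (R.symm (l, w)) = (l, w) := fun w hw ↦ R.right_inv hw
  have hprφ : ∀ w ∈ U, pr (e (φ w)) = w := fun w hw ↦ by
    rw [heφ w hw]; exact congrArg Prod.snd (hΛφ w hw)
  have hfφ : ∀ w ∈ U, f (φ w) = l := fun w hw ↦ congrArg Prod.fst (hΛφ w hw)
  have hφs : ∀ w ∈ U, ContMDiffAt 𝓘(ℝ, F) 𝓘(ℝ, E) ∞ φ w := fun w hw ↦ by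
    have h1 : ContDiffAt ℝ ∞ (fun w : F ↦ R.symm (l, w)) w :=
      (hRsymm _ hw).comp w (contDiffAt_const.prodMk contDiffAt_id)
    exact (contMDiffAt_chart_symm (hφt w hw)).comp w h1.contMDiffAt
  have hinv : ∀ y : M, y ∈ levelSet f l → y ∈ e.source → e y ∈ R.source →
      pr (e y) ∈ U ∧ φ (pr (e y)) = y := by
    intro y hyl hys hyR
    have h1 : Λ (e y) = (l, pr (e y)) := by
      refine Prod.ext ?_ rfl
      change f (e.symm (e y)) = l
      rw [e.left_inv hys]
      exact hyl
    have h2 := R.map_source hyR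
    rw [hRapp, h1] at h2
    refine ⟨h2, ?_⟩
    change e.symm (R.symm (l, pr (e y))) = y
    rw [← h1, ← hRapp, R.left_inv hyR, e.left_inv hys]
  refine ⟨F, φ, U, pr (e x), ⟨hUo, fun w hw ↦ (hφs w hw).contMDiffWithinAt, ?_, ?_⟩,
    hinv x hx (mem_extChartAt_source x) hsrc⟩
  · intro w hw
    have hsource : φ w ∈ (chartAt E x).source := by
      have := e.map_target (hφt w hw)
      rwa [he, extChartAt_source] at this
    -- The left inverse of the differential comes from differentiating `pr ∘ e ∘ φ = id`.
    refine ⟨pr.comp (tder e (φ w) : E →L[ℝ] E), fun v ↦ ?_⟩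
    have h1 := tder_comp (φ := e) (ψ := φ) (x := w) (mdifferentiableAt_extChartAt hsource)
      ((hφs w hw).mdifferentiableAt (by simp)) v
    have h2 := tder_comp (φ := pr) (ψ := fun y ↦ e (φ y)) (x := w)
      pr.differentiableAt.mdifferentiableAt
      ((mdifferentiableAt_extChartAt hsource).comp w ((hφs w hw).mdifferentiableAt (by simp))) v
    rw [h1, tder_eq_fderiv pr, pr.fderiv] at h2
    refine h2.symm.trans ?_
    have h3 : (fun y ↦ pr (e (φ y))) =ᶠ[𝓝 w] fun y ↦ y := by
      filter_upwards [hUo.mem_nhds hw] with y hy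
      exact hprφ y hy
    rw [tder_congr h3, tder_id]
  · have hmaps : MapsTo φ U (levelSet f l) := hfφ
    refine ⟨hmaps, Topology.IsOpenEmbedding.of_continuous_injective_isOpenMap ?_ ?_ ?_⟩
    · exact ContinuousOn.mapsToRestrict
        (fun w hw ↦ (hφs w hw).continuousAt.continuousWithinAt) hmaps
    · rintro ⟨w, hw⟩ ⟨w', hw'⟩ h
      have h' : φ w = φ w' := congrArg Subtype.val h
      refine Subtype.ext ?_
      change w = w'
      rw [← hprφ w hw, h', hprφ w' hw']
    · intro V hV
      obtain ⟨V₀, hV₀, rfl⟩ := isOpen_induced_iff.1 hV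
      -- On the level set near `x`, `pr ∘ e` inverts `φ`, so the image of `V₀` is cut out by the
      -- open condition `pr (e y) ∈ V₀`.
      refine isOpen_induced_iff.2 ⟨e.source ∩ e ⁻¹' (R.source ∩ pr ⁻¹' V₀),
        (continuousOn_extChartAt x).isOpen_inter_preimage (isOpen_extChartAt_source x)
          (R.open_source.inter (hV₀.preimage pr.continuous)), ?_⟩
      ext ⟨y, hy⟩
      constructor
      · rintro ⟨h1, h2, h3⟩
        obtain ⟨h4, h5⟩ := hinv y hy h1 h2
        exact ⟨⟨pr (e y), h4⟩, h3, Subtype.ext h5⟩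
      · rintro ⟨⟨w, hw⟩, hwV, hwy⟩
        have hwy' : φ w = y := congrArg Subtype.val hwy
        subst hwy'
        refine ⟨e.map_target (hφt w hw), ?_, ?_⟩
        · rw [heφ w hw]; exact R.map_target hw
        · change pr (e (φ w)) ∈ V₀
          rw [hprφ w hw]; exact hwV

end Parametrization

/-! ### Uniqueness of geodesics when the metric is strongly nondegenerate -/

section Uniqueness

variable {E : Type*} [NormedAddCommGroup E] [NormedSpace ℝ E]
  {M : Type*} [TopologicalSpace M] [ChartedSpace E M] [IsManifold 𝓘(ℝ, E) ∞ M]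
  {h : ∀ x : M, TangentSpace 𝓘(ℝ, E) x →L[ℝ] TangentSpace 𝓘(ℝ, E) x →L[ℝ] ℝ}

theorem exists_equiv_tder_extChartAt_symm {p : M} {z : E}
    (hz : z ∈ (extChartAt 𝓘(ℝ, E) p).target) :
    ∃ T : E ≃L[ℝ] E, (T : E →L[ℝ] E) = tder (extChartAt 𝓘(ℝ, E) p).symm z := by
  have : IsManifold 𝓘(ℝ, E) 1 M := IsManifold.of_le (n := ∞) (by simp)
  have h1 := isInvertible_mfderivWithin_extChartAt_symm (I := 𝓘(ℝ, E)) hz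
  rw [modelWithCornersSelf_coe, range_id, mfderivWithin_univ] at h1
  exact h1

theorem surjective_tder_extChartAt_symm {p : M} {z : E}
    (hz : z ∈ (extChartAt 𝓘(ℝ, E) p).target) :
    Function.Surjective (tder (extChartAt 𝓘(ℝ, E) p).symm z : E →L[ℝ] E) := by
  obtain ⟨T, hT⟩ := exists_equiv_tder_extChartAt_symm hz
  rw [← hT]
  exact T.surjective

theorem bijective_pullbackForm {p : M} {z : E} (hz : z ∈ (extChartAt 𝓘(ℝ, E) p).target)
    (hb : ∀ x, Function.Bijective (bil h x)) :
    Function.Bijective (pullbackForm h (extChartAt 𝓘(ℝ, E) p).symm z) := by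
  obtain ⟨T, hT⟩ := exists_equiv_tder_extChartAt_symm hz
  have happ : ∀ v w, pullbackForm h (extChartAt 𝓘(ℝ, E) p).symm z v w =
      bil h ((extChartAt 𝓘(ℝ, E) p).symm z) (T v) (T w) := by
    intro v w
    rw [pullbackForm_apply, ← hT]
    rfl
  constructor
  · rw [injective_iff_map_eq_zero]
    intro v hv
    have : T v = 0 := by
      refine (injective_iff_map_eq_zero _).1 (hb ((extChartAt 𝓘(ℝ, E) p).symm z)).1 _ ?_
      ext w
      have := happ v (T.symm w)
      rw [hv, T.apply_symm_apply] at this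
      exact this.symm
    simpa using this
  · intro L
    obtain ⟨x, hx⟩ := (hb ((extChartAt 𝓘(ℝ, E) p).symm z)).2 (L.comp (T.symm : E →L[ℝ] E))
    refine ⟨T.symm x, ?_⟩
    ext w
    rw [happ, T.apply_symm_apply, hx]
    simp

/-- In a chart, a geodesic satisfies the geodesic equation at all nearby times. -/
theorem IsGeodesicOn.eventually_geodesicEqAt (hh : SmoothForms h) (hs : SymmForms h) {γ : ℝ → M}
    {I : Set ℝ} (hI : IsOpen I) (hγ : IsGeodesicOn h γ I) {t : ℝ} (ht : t ∈ I) {p : M}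
    (hp : γ t ∈ (chartAt E p).source) :
    ∀ᶠ s in 𝓝 t, GeodesicEqAt (pullbackForm h (extChartAt 𝓘(ℝ, E) p).symm)
      (fun s ↦ extChartAt 𝓘(ℝ, E) p (γ s)) s := by
  have hsm : ∀ s ∈ I, ContMDiffAt 𝓘(ℝ, ℝ) 𝓘(ℝ, E) ∞ γ s := fun s hs ↦
    (hγ.1 s hs).contMDiffAt (hI.mem_nhds hs)
  have hsource : ∀ s, s ∈ I → γ s ∈ (chartAt E p).source →
      ∀ᶠ r in 𝓝 s, r ∈ I ∧ γ r ∈ (chartAt E p).source := fun s hs hsp ↦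
    (hI.eventually_mem hs).and ((hsm s hs).continuousAt.eventually_mem
      ((chartAt E p).open_source.mem_nhds hsp))
  filter_upwards [hsource t ht hp] with s ⟨hsI, hsp⟩
  have hsp' : γ s ∈ (extChartAt 𝓘(ℝ, E) p).source := by rwa [extChartAt_source]
  have hz := (extChartAt 𝓘(ℝ, E) p).map_source hsp'
  -- `IsGeodesicOn` tests the equation at time `s` in the chart around `γ s`; the inverse of that
  -- chart is used as a parametrization to pass to the fixed chart at `p`.
  refine (geodesicEqAt_chart_iff hh hs (γ := γ) (p := γ s)
    ((contMDiffAt_chart_symm hz).of_le (WithTop.coe_le_coe.2 le_top))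
    ((contDiffAt_extChartAt_comp le_rfl (hsm s hsI) hsp).of_le (WithTop.coe_le_coe.2 le_top)) ?_
    (mem_chart_source E _) (surjective_tder_extChartAt_symm hz)).1 (hγ.2 s hsI)
  filter_upwards [hsource s hsI hsp] with r ⟨_, hr⟩
  exact ((extChartAt 𝓘(ℝ, E) p).left_inv (by rwa [extChartAt_source])).symm

/-- Uniqueness of geodesics of a strongly nondegenerate metric. -/
theorem IsGeodesicOn.eqOn [CompleteSpace E] [T2Space M] (hh : SmoothForms h) (hs : SymmForms h)
    (hb : ∀ x, Function.Bijective (bil h x)) {γ₁ γ₂ : ℝ → M} {I : Set ℝ} (hI : IsTimeInterval I)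
    (hγ₁ : IsGeodesicOn h γ₁ I) (hγ₂ : IsGeodesicOn h γ₂ I) (h0 : γ₁ 0 = γ₂ 0)
    (h1 : vel E γ₁ 0 = vel E γ₂ 0) : EqOn γ₁ γ₂ I := by
  obtain ⟨hIo, hIc, hI0⟩ := hI
  have hM1 : IsManifold 𝓘(ℝ, E) 1 M := IsManifold.of_le (n := ∞) (by simp)
  have hs₁ : ∀ s ∈ I, ContMDiffAt 𝓘(ℝ, ℝ) 𝓘(ℝ, E) ∞ γ₁ s := fun s hs ↦
    (hγ₁.1 s hs).contMDiffAt (hIo.mem_nhds hs)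
  have hs₂ : ∀ s ∈ I, ContMDiffAt 𝓘(ℝ, ℝ) 𝓘(ℝ, E) ∞ γ₂ s := fun s hs ↦
    (hγ₂.1 s hs).contMDiffAt (hIo.mem_nhds hs)
  have hp₁ : ∀ t, γ₁ t ∈ (chartAt E (γ₁ t)).source := fun t ↦ mem_chart_source E _
  have hp₂ : ∀ t, γ₁ t = γ₂ t → γ₂ t ∈ (chartAt E (γ₁ t)).source := fun t ht ↦ ht ▸ hp₁ t
  have hu₁ : ∀ t ∈ I, ContDiffAt ℝ ∞ (fun s ↦ extChartAt 𝓘(ℝ, E) (γ₁ t) (γ₁ s)) t := fun t ht ↦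
    contDiffAt_extChartAt_comp le_rfl (hs₁ t ht) (hp₁ t)
  have hu₂ : ∀ t ∈ I, γ₁ t = γ₂ t →
      ContDiffAt ℝ ∞ (fun s ↦ extChartAt 𝓘(ℝ, E) (γ₁ t) (γ₂ s)) t := fun t ht h ↦
    contDiffAt_extChartAt_comp le_rfl (hs₂ t ht) (hp₂ t h)
  have local_eq : ∀ t ∈ I, γ₁ t = γ₂ t →
      deriv (fun s ↦ extChartAt 𝓘(ℝ, E) (γ₁ t) (γ₁ s)) t =
        deriv (fun s ↦ extChartAt 𝓘(ℝ, E) (γ₁ t) (γ₂ s)) t → γ₁ =ᶠ[𝓝 t] γ₂ := by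
    intro t ht he hd
    have hz := mem_extChartAt_target (I := 𝓘(ℝ, E)) (γ₁ t)
    have := geodesic_eventuallyEq
      (H := pullbackForm h (extChartAt 𝓘(ℝ, E) (γ₁ t)).symm)
      (u₁ := fun s ↦ extChartAt 𝓘(ℝ, E) (γ₁ t) (γ₁ s))
      (u₂ := fun s ↦ extChartAt 𝓘(ℝ, E) (γ₁ t) (γ₂ s))
      (hh.contDiffAt_pullbackForm (n := ∞) le_rfl (WithTop.coe_le_coe.2 le_top)
        (contMDiffAt_chart_symm hz))
      (bijective_pullbackForm hz hb) ((hu₁ t ht).of_le (WithTop.coe_le_coe.2 le_top))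
      ((hu₂ t ht he).of_le (WithTop.coe_le_coe.2 le_top)) (by rw [he]) hd
      (hγ₁.eventually_geodesicEqAt hh hs hIo ht (hp₁ t))
      (hγ₂.eventually_geodesicEqAt hh hs hIo ht (hp₂ t he))
    filter_upwards [this, (hs₁ t ht).continuousAt.eventually_mem
        ((chartAt E (γ₁ t)).open_source.mem_nhds (hp₁ t)),
      (hs₂ t ht).continuousAt.eventually_mem
        ((chartAt E (γ₁ t)).open_source.mem_nhds (hp₂ t he))] with s h1 h2 h3
    exact (extChartAt 𝓘(ℝ, E) (γ₁ t)).injOn (by rwa [extChartAt_source])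
      (by rwa [extChartAt_source]) h1
  -- Connectedness of `I`: the times near which the curves agree form an open set. It is also closed
  -- in `I`, since positions agree in the limit (`M` is Hausdorff), as do velocities in a chart, and
  -- local uniqueness then applies.
  have hopen : IsOpen {t | γ₁ =ᶠ[𝓝 t] γ₂} := isOpen_setOfPred_eventually_nhds
  have h0mem : γ₁ =ᶠ[𝓝 0] γ₂ := by
    refine local_eq 0 hI0 h0 ?_
    have e1 := vel_comp (φ := extChartAt 𝓘(ℝ, E) (γ₁ 0)) (u := γ₁) (t := 0)
      (mdifferentiableAt_extChartAt (hp₁ 0)) ((hs₁ 0 hI0).mdifferentiableAt (by simp))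
    have e2 := vel_comp (φ := extChartAt 𝓘(ℝ, E) (γ₁ 0)) (u := γ₂) (t := 0)
      (mdifferentiableAt_extChartAt (hp₂ 0 h0)) ((hs₂ 0 hI0).mdifferentiableAt (by simp))
    rw [vel_eq_deriv] at e1 e2
    rw [e1, e2, h1, h0]
  have hclosed : closure {t | γ₁ =ᶠ[𝓝 t] γ₂} ∩ I ⊆ {t | γ₁ =ᶠ[𝓝 t] γ₂} := by
    rintro t ⟨htc, htI⟩
    have hfreq : ∃ᶠ s in 𝓝 t, γ₁ =ᶠ[𝓝 s] γ₂ := mem_closure_iff_frequently.1 htc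
    have he : γ₁ t = γ₂ t := tendsto_nhds_unique_of_frequently_eq (hs₁ t htI).continuousAt
      (hs₂ t htI).continuousAt (hfreq.mono fun s hs ↦ hs.eq_of_nhds)
    refine local_eq t htI he ?_
    refine tendsto_nhds_unique_of_frequently_eq
      (contDiffAt_deriv (m := 1) (hu₁ t htI) (WithTop.coe_le_coe.2 le_top)).continuousAt
      (contDiffAt_deriv (m := 1) (hu₂ t htI he) (WithTop.coe_le_coe.2 le_top)).continuousAt
      (hfreq.mono fun s hs ↦ ?_)
    exact (hs.fun_comp (extChartAt 𝓘(ℝ, E) (γ₁ t))).deriv_eq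
  have := hIc.isPreconnected.subset_of_closure_inter_subset hopen ⟨0, hI0, h0mem⟩ hclosed
  exact fun t ht ↦ (this ht).eq_of_nhds

end Uniqueness

/-! ### The geodesic equation of the conformal metric, split into horizontal and radial parts -/

section Slice

variable {E : Type*} [NormedAddCommGroup E] [NormedSpace ℝ E]
  {M : Type*} [TopologicalSpace M] [ChartedSpace E M] [IsManifold 𝓘(ℝ, E) ∞ M]
  {F : Type*} [NormedAddCommGroup F] [NormedSpace ℝ F]
  {m : ℝ → M → M} {g : PseudoRiemannianMetric E M} {f : M → ℝ} {α : ℝ}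

variable {l : ℝ} {φ : F → M} {U : Set F} {σ : ℝ → ℝ} {v : ℝ → F} {γ : ℝ → M} {t : ℝ}

omit [IsManifold 𝓘(ℝ, E) ∞ M] in
theorem IsLocalParametrization.contMDiffAt_exp_act (hm : IsFreePosAction E m) {S : Set M}
    (hφ : IsLocalParametrization E S φ U) {s : ℝ} {y : F} (hy : y ∈ U) :
    ContMDiffAt 𝓘(ℝ, ℝ × F) 𝓘(ℝ, E) ∞ (fun z : ℝ × F ↦ m (Real.exp z.1) (φ z.2)) (s, y) :=
  hm.contMDiffAt_exp_comp le_rfl contDiff_fst.contMDiff.contMDiffAt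
    (ContMDiffAt.comp (s, y) (g := φ) (f := Prod.snd) (hφ.contMDiffAt hy)
      contDiff_snd.contMDiff.contMDiffAt)

theorem IsLocalParametrization.pullbackForm_eventuallyEq_warpedForm (hm : IsFreePosAction E m)
    (hgf : IsHomogeneousPair m g f α) (β : ℝ) (hφ : IsLocalParametrization E (levelSet f l) φ U)
    {s : ℝ} {y : F} (hy : y ∈ U) :
    pullbackForm (conformal g f β) (fun z : ℝ × F ↦ m (Real.exp z.1) (φ z.2)) =ᶠ[𝓝 (s, y)]
      warpedForm (l ^ β) (α * (β + 1)) (α * l) (pullbackForm g.form φ) := by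
  obtain ⟨hS, -⟩ := hφ.isOpenEmbedding
  filter_upwards [continuousAt_snd.eventually_mem (hφ.isOpen.mem_nhds hy)] with ⟨r, w⟩ hw
  refine hgf.pullbackForm_conformal hm β ((hφ.contMDiffAt hw).mdifferentiableAt (by simp))
    ((hφ.contMDiffAt_exp_act hm hw).mdifferentiableAt (by simp)) ?_
  filter_upwards [hφ.isOpen.mem_nhds hw] with w' hw'
  exact hS hw'

/-- The geodesic equation of `f^β g` for a curve `t ↦ m (e^{σ t}) (φ (v t))`. -/
theorem IsLocalParametrization.geodesicEqAt_iff [CompleteSpace E] (hm : IsFreePosAction E m)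
    (hgf : IsHomogeneousPair m g f α) (β : ℝ) (hφ : IsLocalParametrization E (levelSet f l) φ U)
    (hv : v t ∈ U) (hvs : ContDiffAt ℝ 2 v t) (hσ : ContDiffAt ℝ 2 σ t)
    (hγ : γ =ᶠ[𝓝 t] fun s ↦ m (Real.exp (σ s)) (φ (v s))) :
    GeodesicEqAt (pullbackForm (conformal g f β) (extChartAt 𝓘(ℝ, E) (γ t)).symm)
        (fun s ↦ extChartAt 𝓘(ℝ, E) (γ t) (γ s)) t ↔
      (∀ w, geodesicDefect (pullbackForm g.form φ) v t w +
        α * (β + 1) * deriv σ t * pullbackForm g.form φ (v t) (deriv v t) w = 0) ∧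
      α * l * deriv (deriv σ) t + α * (β + 1) / 2 *
        (α * l * deriv σ t ^ 2 - pullbackForm g.form φ (v t) (deriv v t) (deriv v t)) = 0 := by
  obtain ⟨hS, -⟩ := hφ.isOpenEmbedding
  have hl : f (φ (v t)) = l := hS hv
  have hlpos : 0 < l := hl ▸ hgf.pos _
  have hαl : α * l ≠ 0 := mul_ne_zero hgf.degree_ne_zero hlpos.ne'
  have h2 : (2 : ℕ∞ω) ≤ ∞ := WithTop.coe_le_coe.2 le_top
  have hΨ := hφ.contMDiffAt_exp_act hm (s := σ t) hv
  have hsurj : Function.Surjective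
      (tder (fun z : ℝ × F ↦ m (Real.exp z.1) (φ z.2)) (σ t, v t) : ℝ × F →L[ℝ] E) := by
    intro x
    obtain ⟨x', rfl⟩ := hm.tder_act_surjective (Real.exp_pos (σ t)) (φ (v t)) x
    -- Subtracting `a P` makes `df` vanish: the tangent space is spanned by `P` and the tangent
    -- space of the level set. Hence polar coordinates are submersive and lose no test vector.
    let a : ℝ := (tder f (φ (v t)) : E →L[ℝ] ℝ) x' / (α * l)
    obtain ⟨w, hw⟩ := hφ.mem_range_tder hm hgf hv (w := x' - a • gen E m (φ (v t))) (by
      rw [map_sub, map_smul, hgf.tder_gen hm, hl, smul_eq_mul, div_mul_cancel₀ _ hαl, sub_self])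
    refine ⟨(a, w), ?_⟩
    rw [hm.tder_exp_act ((hφ.contMDiffAt hv).mdifferentiableAt (by simp))
      (hΨ.mdifferentiableAt (by simp)), hw, add_sub_cancel]
  have hG₀ : ContDiffAt ℝ 1 (pullbackForm g.form φ) (v t) :=
    g.smoothForms.contDiffAt_pullbackForm le_rfl (WithTop.coe_le_coe.2 le_top) (hφ.contMDiffAt hv)
  rw [geodesicEqAt_chart_iff (smoothForms_conformal g hgf.smooth hgf.pos β)
    (symmForms_conformal g f β) (φ := fun z : ℝ × F ↦ m (Real.exp z.1) (φ z.2))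
    (u := fun s ↦ (σ s, v s)) (hΨ.of_le h2) (hσ.prodMk hvs) hγ (mem_chart_source E _) hsurj,
    geodesicEqAt_iff_geodesicDefect]
  simp only [geodesicDefect_congr (EventuallyEq.refl (𝓝 t) fun s ↦ (σ s, v s))
    (hφ.pullbackForm_eventuallyEq_warpedForm hm hgf β hv), geodesicDefect_warpedForm hG₀ hσ hvs]
  have hc : l ^ β * Real.exp (α * (β + 1) * σ t) ≠ 0 :=
    mul_ne_zero (Real.rpow_pos_of_pos hlpos β).ne' (Real.exp_pos _).ne'
  simp only [mul_eq_zero, hc, false_or]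
  constructor
  -- The test vectors `(0, w)` give the horizontal part, and `(1, 0)` the radial part.
  · intro H
    refine ⟨fun w ↦ ?_, ?_⟩
    · simpa using H (0, w)
    · simpa [geodesicDefect, christoffel] using H (1, 0)
  · rintro ⟨H1, H2⟩ ⟨a, w⟩
    rw [H2, zero_mul, add_zero]
    exact H1 w

/-- The energy of `t ↦ m (e^{σ t}) (φ (v t))` for `f^β g`. -/
theorem IsLocalParametrization.energy_conformal (hm : IsFreePosAction E m)
    (hgf : IsHomogeneousPair m g f α) (β : ℝ) (hφ : IsLocalParametrization E (levelSet f l) φ U)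
    (hv : v t ∈ U) (hvs : DifferentiableAt ℝ v t) (hσ : DifferentiableAt ℝ σ t)
    (hγ : γ =ᶠ[𝓝 t] fun s ↦ m (Real.exp (σ s)) (φ (v s))) :
    energy (conformal g f β) γ t = l ^ β * Real.exp (α * (β + 1) * σ t) *
      (pullbackForm g.form φ (v t) (deriv v t) (deriv v t) + α * l * deriv σ t ^ 2) := by
  have hΨ := hφ.contMDiffAt_exp_act hm (s := σ t) hv
  rw [energy_eq_pullbackForm (φ := fun z : ℝ × F ↦ m (Real.exp z.1) (φ z.2))
    (u := fun s ↦ (σ s, v s)) (hΨ.mdifferentiableAt (by simp)) (hσ.prodMk hvs) hγ,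
    (hφ.pullbackForm_eventuallyEq_warpedForm hm hgf β hv).eq_of_nhds, warpedForm_apply,
    (hσ.hasDerivAt.prodMk hvs.hasDerivAt).deriv]
  simp only [sq]

/-- After a change of parameter, the horizontal part of the geodesic equation of `f^β g` is the
geodesic equation of the level set. -/
theorem geodesicEqAt_reparam_iff {G : F → F →L[ℝ] F →L[ℝ] ℝ} {u : ℝ → F} {τ : ℝ → ℝ} {k s : ℝ}
    (hu : ContDiffAt ℝ 2 u (τ t)) (hτ : ContDiffAt ℝ 2 τ t) (hτ' : deriv τ t ≠ 0)
    (hτ'' : deriv (deriv τ) t = -(k * s * deriv τ t)) (hv : v =ᶠ[𝓝 t] fun s ↦ u (τ s)) :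
    (∀ w, geodesicDefect G v t w + k * s * G (v t) (deriv v t) w = 0) ↔
      GeodesicEqAt G u (τ t) := by
  have hd : deriv v t = deriv τ t • deriv u (τ t) := by
    rw [hv.deriv_eq]
    exact ((hu.differentiableAt two_ne_zero).hasDerivAt.scomp t
      (hτ.differentiableAt two_ne_zero).hasDerivAt).deriv
  rw [geodesicEqAt_iff_geodesicDefect]
  refine forall_congr' fun w ↦ ?_
  rw [geodesicDefect_congr hv (EventuallyEq.refl _ _), geodesicDefect_comp hu hτ, hd, hτ'',
    hv.eq_of_nhds]
  -- The term from `τ'' = -k s τ'` cancels the term proportional to the velocity.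
  have : deriv τ t ^ 2 * geodesicDefect G u (τ t) w +
      -(k * s * deriv τ t) * G (u (τ t)) (deriv u (τ t)) w +
      k * s * G (u (τ t)) (deriv τ t • deriv u (τ t)) w =
      deriv τ t ^ 2 * geodesicDefect G u (τ t) w := by
    simp only [map_smul, smul_apply, smul_eq_mul]
    ring
  rw [this, mul_eq_zero, or_iff_right (pow_ne_zero 2 hτ')]

end Slice

/-! ### One-variable calculus on time intervals -/

section Calculus

variable {I : Set ℝ}

theorem IsTimeInterval.eq_of_hasDerivAt_zero (hI : IsTimeInterval I) {W : ℝ → ℝ}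
    (h : ∀ t ∈ I, HasDerivAt W 0 t) {t : ℝ} (ht : t ∈ I) : W t = W 0 :=
  hI.1.is_const_of_deriv_eq_zero hI.2.1.isPreconnected
    (fun s hs ↦ (h s hs).differentiableAt.differentiableWithinAt) (fun s hs ↦ (h s hs).deriv)
    ht hI.2.2

theorem IsTimeInterval.eq_quadratic (hI : IsTimeInterval I) {W : ℝ → ℝ} {c : ℝ}
    (hW : ∀ t ∈ I, ContDiffAt ℝ 2 W t) (h : ∀ t ∈ I, deriv (deriv W) t = 2 * c) {t : ℝ}
    (ht : t ∈ I) : W t = W 0 + deriv W 0 * t + c * t ^ 2 := by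
  have h1 : ∀ t ∈ I, deriv W t = deriv W 0 + 2 * c * t := by
    intro t ht
    have := hI.eq_of_hasDerivAt_zero (W := fun t ↦ deriv W t - 2 * c * t) (fun s hs ↦ by
      have := (hasDerivAt_deriv_of_contDiffAt (hW s hs)).sub
        ((hasDerivAt_id s).const_mul (2 * c))
      rw [h s hs, mul_one, sub_self] at this
      exact this) ht
    simp only [mul_zero, sub_zero] at this
    linarith
  have := hI.eq_of_hasDerivAt_zero (W := fun t ↦ W t - (deriv W 0 * t + c * t ^ 2)) (fun s hs ↦ by
      have := ((hW s hs).differentiableAt two_ne_zero).hasDerivAt.sub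
        (((hasDerivAt_id s).const_mul (deriv W 0)).add (((hasDerivAt_id s).pow 2).const_mul c))
      refine this.congr_deriv ?_
      rw [h1 s hs]
      simp
      ring) ht
  simp only [mul_zero, sub_zero, add_zero, ne_eq, OfNat.ofNat_ne_zero, not_false_eq_true,
    zero_pow] at this
  linarith

theorem contDiffAt_of_hasDerivAt (hI : IsOpen I) {τ w : ℝ → ℝ}
    (h : ∀ t ∈ I, HasDerivAt τ (w t) t) (hw : ∀ t ∈ I, ContDiffAt ℝ ∞ w t) {t : ℝ} (ht : t ∈ I) :
    ContDiffAt ℝ ∞ τ t := by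
  have : ContDiffOn ℝ ∞ τ I := by
    rw [contDiffOn_infty_iff_deriv_of_isOpen hI]
    refine ⟨fun s hs ↦ (h s hs).differentiableAt.differentiableWithinAt, ?_⟩
    exact ContDiffOn.congr (fun s hs ↦ (hw s hs).contDiffWithinAt) fun s hs ↦ (h s hs).deriv
  exact this.contDiffAt (hI.mem_nhds ht)

/-- The smooth inverse of a smooth function with positive derivative on an interval. -/
theorem IsTimeInterval.exists_inverse (hI : IsTimeInterval I) {τ : ℝ → ℝ}
    (hτ : ∀ t ∈ I, ContDiffAt ℝ ∞ τ t) (hpos : ∀ t ∈ I, 0 < deriv τ t) (h0 : τ 0 = 0) :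
    IsTimeInterval (τ '' I) ∧ ∃ T : ℝ → ℝ, (∀ t ∈ I, T (τ t) = t) ∧
      ∀ t ∈ I, ContDiffAt ℝ ∞ T (τ t) := by
  obtain ⟨hIo, hIc, hI0⟩ := hI
  have hcont : ContinuousOn τ I := fun t ht ↦ (hτ t ht).continuousAt.continuousWithinAt
  have hmono : StrictMonoOn τ I :=
    strictMonoOn_of_deriv_pos hIc.convex hcont fun t ht ↦ hpos t (interior_subset ht)
  have hinj := hmono.injOn
  let T := Function.invFunOn τ I
  have hT : ∀ t ∈ I, T (τ t) = t := fun t ht ↦ hinj.leftInvOn_invFunOn ht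
  -- The global inverse `T` is obtained by choice, so its regularity is not visible. The local
  -- inverses `K` are smooth with values in `I`, and they agree with `T` by injectivity; they also
  -- show that the image of `I` is open.
  have key : ∀ t ∈ I, ∃ K : ℝ → ℝ, ContDiffAt ℝ ∞ K (τ t) ∧
      ∀ᶠ s in 𝓝 (τ t), K s ∈ I ∧ τ (K s) = s := by
    intro t ht
    have hd := (((hτ t ht).differentiableAt (by simp)).hasDerivAt).hasFDerivAt_equiv (hpos t ht).ne'
    let R := (hτ t ht).toOpenPartialHomeomorph τ hd (by simp)
    have hsrc : t ∈ R.source := (hτ t ht).mem_toOpenPartialHomeomorph_source hd (by simp)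
    have hK : ContDiffAt ℝ ∞ R.symm (τ t) := (hτ t ht).to_localInverse hd (by simp)
    have hKt : R.symm (τ t) = t := R.left_inv hsrc
    refine ⟨R.symm, hK, ?_⟩
    filter_upwards [hK.continuousAt.eventually_mem (hIo.mem_nhds (by rw [hKt]; exact ht)),
      R.open_target.mem_nhds (R.map_source hsrc)] with s hs1 hs2
    exact ⟨hs1, R.right_inv hs2⟩
  refine ⟨⟨?_, (hIc.isPreconnected.image τ hcont).ordConnected, 0, hI0, h0⟩, T, hT, ?_⟩
  · rw [isOpen_iff_mem_nhds]
    rintro _ ⟨t, ht, rfl⟩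
    obtain ⟨K, -, hK⟩ := key t ht
    filter_upwards [hK] with s hs
    exact ⟨K s, hs⟩
  · intro t ht
    obtain ⟨K, hKs, hK⟩ := key t ht
    refine hKs.congr_of_eventuallyEq ?_
    filter_upwards [hK] with s hs
    rw [← hT _ hs.1, hs.2]

end Calculus

/-! ### Projecting geodesics to the level set and lifting them back -/

section Correspondence

variable {E : Type*} [NormedAddCommGroup E] [NormedSpace ℝ E]
  {M : Type*} [TopologicalSpace M] [ChartedSpace E M]
  {m : ℝ → M → M}

theorem vel_comp_real {y : ℝ → M} {τ : ℝ → ℝ} {t : ℝ}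
    (hy : MDifferentiableAt 𝓘(ℝ, ℝ) 𝓘(ℝ, E) y (τ t)) (hτ : DifferentiableAt ℝ τ t) :
    vel E (fun s ↦ y (τ s)) t = deriv τ t • vel E y (τ t) := by
  rw [vel_comp hy hτ.mdifferentiableAt, vel_eq_deriv, vel, ← map_smul, smul_eq_mul, mul_one]

/-- Differentiating `τ' = e^{-k σ}` gives the relation under which `geodesicEqAt_reparam_iff`
removes the term `k σ' v'`. -/
theorem deriv_deriv_of_hasDerivAt_exp {I : Set ℝ} (hI : IsOpen I) {σ τ : ℝ → ℝ} {k : ℝ}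
    (hτ : ∀ t ∈ I, HasDerivAt τ (Real.exp (-(k * σ t))) t) {t : ℝ} (ht : t ∈ I)
    (hσ : DifferentiableAt ℝ σ t) :
    deriv (deriv τ) t = -(k * deriv σ t * deriv τ t) := by
  have h1 : deriv τ =ᶠ[𝓝 t] fun s ↦ Real.exp (-(k * σ s)) := by
    filter_upwards [hI.mem_nhds ht] with s hs
    exact (hτ s hs).deriv
  rw [h1.deriv_eq, h1.eq_of_nhds]
  refine ((hσ.hasDerivAt.const_mul k).neg.exp).deriv.trans ?_
  simp only [Pi.neg_apply]
  ring

theorem IsSubmanifoldGeodesicOn.contMDiffAt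
    {h : ∀ x : M, TangentSpace 𝓘(ℝ, E) x →L[ℝ] TangentSpace 𝓘(ℝ, E) x →L[ℝ] ℝ} {S : Set M}
    {y : ℝ → M} {J : Set ℝ} (hy : IsSubmanifoldGeodesicOn h S y J) {s : ℝ} (hs : s ∈ J) :
    ContMDiffAt 𝓘(ℝ, ℝ) 𝓘(ℝ, E) ∞ y s := by
  obtain ⟨F, φ, U, u, hφ, hu, hus, hyu, -⟩ := hy s hs
  exact (ContMDiffAt.comp s (g := φ) (f := u) (hφ.contMDiffAt hu) hus.contMDiffAt).congr_of_eventuallyEq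
    hyu

variable [IsManifold 𝓘(ℝ, E) ∞ M]

theorem IsSubmanifoldGeodesicOn.hasDerivAt_energy
    {h : ∀ x : M, TangentSpace 𝓘(ℝ, E) x →L[ℝ] TangentSpace 𝓘(ℝ, E) x →L[ℝ] ℝ}
    (hh : SmoothForms h) (hs : SymmForms h) {S : Set M}
    {y : ℝ → M} {J : Set ℝ} (hy : IsSubmanifoldGeodesicOn h S y J) {s : ℝ} (hsJ : s ∈ J) :
    HasDerivAt (energy h y) 0 s := by
  obtain ⟨F, φ, U, u, hφ, hu, hus, hyu, hgeo⟩ := hy s hsJ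
  exact hasDerivAt_energy_of_geodesic hh hs ((hφ.contMDiffAt hu).of_le (WithTop.coe_le_coe.2 le_top))
    (hus.of_le (WithTop.coe_le_coe.2 le_top)) hyu hgeo

omit [IsManifold 𝓘(ℝ, E) ∞ M] in
theorem IsGeodesicOn.contMDiffAt
    {h : ∀ x : M, TangentSpace 𝓘(ℝ, E) x →L[ℝ] TangentSpace 𝓘(ℝ, E) x →L[ℝ] ℝ}
    {γ : ℝ → M} {I : Set ℝ} (hI : IsOpen I) (hγ : IsGeodesicOn h γ I) {t : ℝ} (ht : t ∈ I) :
    ContMDiffAt 𝓘(ℝ, ℝ) 𝓘(ℝ, E) ∞ γ t :=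
  (hγ.1 t ht).contMDiffAt (hI.mem_nhds ht)

theorem IsGeodesicOn.hasDerivAt_energy
    {h : ∀ x : M, TangentSpace 𝓘(ℝ, E) x →L[ℝ] TangentSpace 𝓘(ℝ, E) x →L[ℝ] ℝ}
    (hh : SmoothForms h) (hs : SymmForms h)
    {γ : ℝ → M} {I : Set ℝ} (hI : IsOpen I) (hγ : IsGeodesicOn h γ I) {t : ℝ} (ht : t ∈ I) :
    HasDerivAt (energy h γ) 0 t := by
  have hp := mem_chart_source E (γ t)
  have hsm := hγ.contMDiffAt hI ht
  refine hasDerivAt_energy_of_geodesic hh hs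
    ((contMDiffAt_chart_symm (mem_extChartAt_target (γ t))).of_le (WithTop.coe_le_coe.2 le_top))
    ((contDiffAt_extChartAt_comp le_rfl hsm hp).of_le (WithTop.coe_le_coe.2 le_top)) ?_ (hγ.2 t ht)
  filter_upwards [hsm.continuousAt.eventually_mem (extChartAt_source_mem_nhds (I := 𝓘(ℝ, E)) (γ t))]
    with s hs
  exact ((extChartAt 𝓘(ℝ, E) (γ t)).left_inv hs).symm

variable [CompleteSpace E] {g : PseudoRiemannianMetric E M} {f : M → ℝ} {α : ℝ}

/-- The projection to the level set of a smooth curve, in a local parametrization. -/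
theorem exists_projection (hm : IsFreePosAction E m) (hgf : IsHomogeneousPair m g f α) {l : ℝ}
    {γ : ℝ → M} {σ : ℝ → ℝ} {t : ℝ} (hγ : ContMDiffAt 𝓘(ℝ, ℝ) 𝓘(ℝ, E) ∞ γ t)
    (hσ : ContDiffAt ℝ ∞ σ t) (hl : ∀ᶠ s in 𝓝 t, f (γ s) = l * Real.exp (α * σ s)) :
    ∃ (F : Submodule ℝ E) (φ : F → M) (U : Set F) (v : ℝ → F),
      IsLocalParametrization E (levelSet f l) φ U ∧ v t ∈ U ∧ ContDiffAt ℝ ∞ v t ∧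
      ∀ᶠ s in 𝓝 t, m (Real.exp (-σ s)) (γ s) = φ (v s) := by
  let z : ℝ → M := fun s ↦ m (Real.exp (-σ s)) (γ s)
  have hz : ContMDiffAt 𝓘(ℝ, ℝ) 𝓘(ℝ, E) ∞ z t :=
    hm.contMDiffAt_exp_comp le_rfl hσ.neg.contMDiffAt hγ
  have hzl : ∀ᶠ s in 𝓝 t, z s ∈ levelSet f l := by
    filter_upwards [hl] with s hs
    change f (m (Real.exp (-σ s)) (γ s)) = l
    rw [hgf.apply_exp, hs, mul_neg, Real.exp_neg, mul_left_comm, inv_mul_cancel₀ (Real.exp_pos _).ne',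
      mul_one]
  obtain ⟨F, φ, U, u₀, hφ, hu₀, hφu₀⟩ := exists_isLocalParametrization hm hgf hzl.self_of_nhds
  obtain ⟨π, hπ, hπφ, hφπ⟩ := hφ.exists_retraction hu₀
  rw [hφu₀] at hπ hφπ
  refine ⟨F, φ, U, fun s ↦ π (z s), hφ, ?_, ?_, ?_⟩
  · change π (z t) ∈ U
    rw [← hφu₀, hπφ.self_of_nhds]
    exact hu₀
  · exact (ContMDiffAt.comp t (g := π) (f := z) hπ hz).contDiffAt
  · filter_upwards [hzl, hz.continuousAt.eventually hφπ] with s h1 h2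
    exact (h2 h1).symm

/-- The equation for the radial component of a geodesic of `f^β g`. -/
theorem IsGeodesicOn.radial (hm : IsFreePosAction E m)
    (hgf : IsHomogeneousPair m g f α) {l β : ℝ} {γ : ℝ → M} {I : Set ℝ} (hI : IsOpen I)
    (hγ : IsGeodesicOn (conformal g f β) γ I) {σ : ℝ → ℝ} {t : ℝ} (ht : t ∈ I)
    (hσ : ContDiffAt ℝ ∞ σ t) (hl : ∀ s ∈ I, f (γ s) = l * Real.exp (α * σ s)) :
    ∃ Q : ℝ, α * l * deriv (deriv σ) t + α * (β + 1) / 2 * (α * l * deriv σ t ^ 2 - Q) = 0 ∧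
      energy (conformal g f β) γ t = l ^ β * Real.exp (α * (β + 1) * σ t) *
        (Q + α * l * deriv σ t ^ 2) := by
  have h2 : (2 : ℕ∞ω) ≤ ∞ := WithTop.coe_le_coe.2 le_top
  obtain ⟨F, φ, U, v, hφ, hv, hvs, hz⟩ := exists_projection hm hgf (l := l)
    (hγ.contMDiffAt hI ht) hσ (eventually_of_mem (hI.mem_nhds ht) hl)
  have heq : γ =ᶠ[𝓝 t] fun s ↦ m (Real.exp (σ s)) (φ (v s)) := by
    filter_upwards [hz] with s hs
    rw [← hs, hm.exp_act_neg]
  -- `Q` is the squared speed `G₀(v', v')` of the projected curve. It stays anonymous, since it will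
  -- be eliminated between the two equations.
  refine ⟨_, ((hφ.geodesicEqAt_iff hm hgf β hv (hvs.of_le h2) (hσ.of_le h2) heq).1 (hγ.2 t ht)).2, ?_⟩
  exact hφ.energy_conformal hm hgf β hv (hvs.differentiableAt (by simp))
    (hσ.differentiableAt (by simp)) heq

/-- A geodesic of `f^β g` projects to a reparametrized geodesic of the level set. -/
theorem IsGeodesicOn.exists_levelSet_geodesic (hm : IsFreePosAction E m)
    (hgf : IsHomogeneousPair m g f α) {l β : ℝ} {γ : ℝ → M} {I : Set ℝ} (hI : IsTimeInterval I)
    (hγ : IsGeodesicOn (conformal g f β) γ I) {σ τ : ℝ → ℝ}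
    (hσ : ∀ t ∈ I, ContDiffAt ℝ ∞ σ t) (hl : ∀ s ∈ I, f (γ s) = l * Real.exp (α * σ s))
    (hσ0 : σ 0 = 0) (hτ0 : τ 0 = 0)
    (hτ : ∀ t ∈ I, HasDerivAt τ (Real.exp (-(α * (β + 1) * σ t))) t) :
    ∃ (J : Set ℝ) (y : ℝ → M), IsTimeInterval J ∧
      IsSubmanifoldGeodesicOn g.form (levelSet f l) y J ∧ y 0 = γ 0 ∧
      vel E y 0 = vel E γ 0 - deriv σ 0 • gen E m (γ 0) ∧
      ∀ t ∈ I, τ t ∈ J ∧ γ t = m (Real.exp (σ t)) (y (τ t)) := by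
  have h2 : (2 : ℕ∞ω) ≤ ∞ := WithTop.coe_le_coe.2 le_top
  have hI0 := hI.2.2
  have hτs : ∀ t ∈ I, ContDiffAt ℝ ∞ τ t := fun t ht ↦
    contDiffAt_of_hasDerivAt hI.1 hτ (fun s hs ↦ (contDiffAt_const.mul (hσ s hs)).neg.exp) ht
  have hτpos : ∀ t ∈ I, 0 < deriv τ t := fun t ht ↦ by
    rw [(hτ t ht).deriv]; exact Real.exp_pos _
  obtain ⟨hJ, T, hT, hTs⟩ := hI.exists_inverse hτs hτpos hτ0
  let z : ℝ → M := fun r ↦ m (Real.exp (-σ r)) (γ r)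
  have hT0 : T 0 = 0 := by
    have := hT 0 hI0
    rwa [hτ0] at this
  have hT' : deriv T 0 = 1 := by
    have h1 : (fun s ↦ T (τ s)) =ᶠ[𝓝 0] fun s ↦ s := by
      filter_upwards [hI.1.mem_nhds hI0] with s hs
      exact hT s hs
    have h3 := (((hTs 0 hI0).differentiableAt (by simp)).hasDerivAt).comp (0 : ℝ) (hτ 0 hI0)
    have h4 := (hasDerivAt_id' (0 : ℝ)).congr_of_eventuallyEq h1
    have := h3.unique h4
    rwa [hσ0, hτ0, mul_zero, neg_zero, Real.exp_zero, mul_one] at this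
  refine ⟨τ '' I, fun s ↦ z (T s), hJ, ?_, ?_, ?_, ?_⟩
  · rintro _ ⟨t, ht, rfl⟩
    obtain ⟨F, φ, U, v, hφ, hv, hvs, hz⟩ := exists_projection hm hgf (l := l)
      (hγ.contMDiffAt hI.1 ht) (hσ t ht) (eventually_of_mem (hI.1.mem_nhds ht) hl)
    have heq : γ =ᶠ[𝓝 t] fun s ↦ m (Real.exp (σ s)) (φ (v s)) := by
      filter_upwards [hz] with s hs
      rw [← hs, hm.exp_act_neg]
    have hvT : ContDiffAt ℝ ∞ v (T (τ t)) := by rw [hT t ht]; exact hvs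
    have hus : ContDiffAt ℝ ∞ (fun s ↦ v (T s)) (τ t) := hvT.comp (τ t) (hTs t ht)
    refine ⟨F, φ, U, fun s ↦ v (T s), hφ, ?_, hus, ?_, ?_⟩
    · change v (T (τ t)) ∈ U
      rw [hT t ht]; exact hv
    · have := (hTs t ht).continuousAt
      rw [ContinuousAt, hT t ht] at this
      exact this.eventually hz
    · refine (geodesicEqAt_reparam_iff (v := v) (t := t) (τ := τ) (k := α * (β + 1))
        (s := deriv σ t) (hus.of_le h2) ((hτs t ht).of_le h2) (hτpos t ht).ne'
        (deriv_deriv_of_hasDerivAt_exp hI.1 hτ ht ((hσ t ht).differentiableAt (by simp))) ?_).1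
        ((hφ.geodesicEqAt_iff hm hgf β hv (hvs.of_le h2) ((hσ t ht).of_le h2) heq).1 (hγ.2 t ht)).1
      filter_upwards [hI.1.mem_nhds ht] with s hs
      rw [hT s hs]
  · change m (Real.exp (-σ (T 0))) (γ (T 0)) = γ 0
    rw [hT0, hσ0, neg_zero, Real.exp_zero, hm.one_act]
  · have hγs := hγ.contMDiffAt hI.1 hI0
    have hzs : ContMDiffAt 𝓘(ℝ, ℝ) 𝓘(ℝ, E) ∞ z 0 :=
      hm.contMDiffAt_exp_comp le_rfl (hσ 0 hI0).neg.contMDiffAt hγs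
    have hTs0 := hTs 0 hI0
    rw [hτ0] at hTs0
    rw [vel_comp_real (y := z) (τ := T) (by rw [hT0]; exact hzs.mdifferentiableAt (by simp))
      (hTs0.differentiableAt (by simp)), hT', hT0, one_smul]
    have := hm.vel_exp_act (s := fun r ↦ -σ r) (c := γ) (t := 0)
      ((hσ 0 hI0).neg.differentiableAt (by simp)) (hγs.of_le (WithTop.coe_le_coe.2 le_top))
    rw [show vel E z 0 = _ from this]
    simp only [hσ0, neg_zero, Real.exp_zero]
    rw [show m 1 = fun x ↦ x from funext hm.one_act, tder_id, deriv.fun_neg, neg_smul]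
    abel
  · intro t ht
    refine ⟨⟨t, ht, rfl⟩, ?_⟩
    change γ t = m (Real.exp (σ t)) (m (Real.exp (-σ (T (τ t)))) (γ (T (τ t))))
    rw [hT t ht, hm.exp_act_neg]

/-- A geodesic of the level set lifts to a geodesic of `f^β g`. -/
theorem IsSubmanifoldGeodesicOn.isGeodesicOn_conformal (hm : IsFreePosAction E m)
    (hgf : IsHomogeneousPair m g f α) {l β : ℝ} {y γ : ℝ → M} {I J : Set ℝ} (hI : IsTimeInterval I)
    (hJ : IsTimeInterval J) (hy : IsSubmanifoldGeodesicOn g.form (levelSet f l) y J) {σ τ : ℝ → ℝ}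
    (hσ : ∀ t ∈ I, ContDiffAt ℝ ∞ σ t) (hσ0 : σ 0 = 0) (hτ0 : τ 0 = 0)
    (hτ : ∀ t ∈ I, HasDerivAt τ (Real.exp (-(α * (β + 1) * σ t))) t)
    (hode : ∀ t ∈ I, α * l * deriv (deriv σ) t + α * (β + 1) / 2 * (α * l * deriv σ t ^ 2 -
      energy g.form y 0 * Real.exp (-(α * (β + 1) * σ t)) ^ 2) = 0)
    (hγ : ∀ t ∈ I, τ t ∈ J ∧ γ t = m (Real.exp (σ t)) (y (τ t))) :
    IsGeodesicOn (conformal g f β) γ I ∧ γ 0 = y 0 ∧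
      vel E γ 0 = deriv σ 0 • gen E m (y 0) + vel E y 0 := by
  have h2 : (2 : ℕ∞ω) ≤ ∞ := WithTop.coe_le_coe.2 le_top
  have hI0 := hI.2.2
  have hτs : ∀ t ∈ I, ContDiffAt ℝ ∞ τ t := fun t ht ↦
    contDiffAt_of_hasDerivAt hI.1 hτ (fun s hs ↦ (contDiffAt_const.mul (hσ s hs)).neg.exp) ht
  have hev : ∀ t ∈ I, γ =ᶠ[𝓝 t] fun s ↦ m (Real.exp (σ s)) (y (τ s)) := fun t ht ↦ by
    filter_upwards [hI.1.mem_nhds ht] with s hs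
    exact (hγ s hs).2
  have hyτ : ∀ t ∈ I, ContMDiffAt 𝓘(ℝ, ℝ) 𝓘(ℝ, E) ∞ (fun s ↦ y (τ s)) t := fun t ht ↦
    ContMDiffAt.comp t (g := y) (f := τ) (hy.contMDiffAt (hγ t ht).1) (hτs t ht).contMDiffAt
  refine ⟨⟨fun t ht ↦ ?_, fun t ht ↦ ?_⟩, ?_, ?_⟩
  · exact ((hm.contMDiffAt_exp_comp le_rfl (hσ t ht).contMDiffAt
      (hyτ t ht)).congr_of_eventuallyEq (hev t ht)).contMDiffWithinAt
  · obtain ⟨F, φ, U, u, hφ, hu, hus, hyu, hgeo⟩ := hy (τ t) (hγ t ht).1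
    have hvs : ContDiffAt ℝ ∞ (fun s ↦ u (τ s)) t := hus.comp t (hτs t ht)
    have heq : γ =ᶠ[𝓝 t] fun s ↦ m (Real.exp (σ s)) (φ (u (τ s))) := by
      filter_upwards [hev t ht, (hτs t ht).continuousAt.eventually hyu] with s h1 h3
      rw [h1, h3]
    -- The energy of `y` is constant, so its squared speed at `τ t` is the initial one. The squared
    -- speed of `y ∘ τ` is thus the initial energy times `τ'²`, as in `hode`.
    have hen : energy g.form y 0 = pullbackForm g.form φ (u (τ t)) (deriv u (τ t))
        (deriv u (τ t)) := by
      rw [← hJ.eq_of_hasDerivAt_zero (fun s hs ↦ hy.hasDerivAt_energy g.smoothForms g.symmForms hs)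
        (hγ t ht).1]
      exact energy_eq_pullbackForm ((hφ.contMDiffAt hu).mdifferentiableAt (by simp))
        (hus.differentiableAt (by simp)) hyu
    refine (hφ.geodesicEqAt_iff hm hgf β (v := fun s ↦ u (τ s)) hu (hvs.of_le h2)
      ((hσ t ht).of_le h2) heq).2 ⟨?_, ?_⟩
    · exact (geodesicEqAt_reparam_iff (hus.of_le h2) ((hτs t ht).of_le h2)
        (by rw [(hτ t ht).deriv]; exact (Real.exp_pos _).ne')
        (deriv_deriv_of_hasDerivAt_exp hI.1 hτ ht ((hσ t ht).differentiableAt (by simp)))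
        (EventuallyEq.refl _ _)).2 hgeo
    · have hd : deriv (fun s ↦ u (τ s)) t =
          Real.exp (-(α * (β + 1) * σ t)) • deriv u (τ t) :=
        ((hus.differentiableAt (by simp)).hasDerivAt.scomp t (hτ t ht)).deriv
      rw [hd, ← hode t ht, hen]
      simp only [map_smul, smul_apply, smul_eq_mul]
      ring
  · rw [(hγ 0 hI0).2, hσ0, hτ0, Real.exp_zero, hm.one_act]
  · have hy0 := hy.contMDiffAt hJ.2.2
    rw [vel_congr (hev 0 hI0), hm.vel_exp_act ((hσ 0 hI0).differentiableAt (by simp))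
      ((hyτ 0 hI0).of_le (WithTop.coe_le_coe.2 le_top)),
      vel_comp_real (y := y) (τ := τ) (by rw [hτ0]; exact hy0.mdifferentiableAt (by simp))
        (hτ 0 hI0).differentiableAt, (hτ 0 hI0).deriv, hσ0, hτ0, mul_zero, neg_zero, Real.exp_zero,
      one_smul, show m 1 = fun x ↦ x from funext hm.one_act, tder_id]

end Correspondence

/-! ### The quadratic polynomial `μ` and the time change it defines -/

section Mu

theorem hasDerivAt_mu (α l a q β t : ℝ) :
    HasDerivAt (mu α l a q β) (a / l * (β + 1) + 2 * (α / (4 * l) * q * (β + 1) ^ 2) * t) t := by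
  have h := (((hasDerivAt_id t).const_mul (a / l * (β + 1))).const_add 1).add
    (((hasDerivAt_id t).pow 2).const_mul (α / (4 * l) * q * (β + 1) ^ 2))
  refine (h.congr_deriv ?_).congr_of_eventuallyEq ?_
  · simp
    ring
  · exact Eventually.of_forall fun s ↦ rfl

theorem contDiff_mu {n : ℕ∞ω} (α l a q β : ℝ) : ContDiff ℝ n (mu α l a q β) := by
  unfold mu
  fun_prop

theorem mu_zero (α l a q β : ℝ) : mu α l a q β 0 = 1 := by
  simp [mu]

theorem hasDerivAt_integral_inv_mu {α l a q β : ℝ} {I : Set ℝ} (hI : IsTimeInterval I)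
    (hpos : ∀ t ∈ I, 0 < mu α l a q β t) {t : ℝ} (ht : t ∈ I) :
    HasDerivAt (fun t ↦ ∫ τ in (0 : ℝ)..t, 1 / mu α l a q β τ) (1 / mu α l a q β t) t := by
  have hc : ContinuousOn (fun τ ↦ 1 / mu α l a q β τ) I :=
    continuousOn_const.div (contDiff_mu (n := 0) α l a q β).continuous.continuousOn
      fun s hs ↦ (hpos s hs).ne'
  refine intervalIntegral.integral_hasDerivAt_right ?_ ?_ (hc.continuousAt (hI.1.mem_nhds ht))
  · exact (hc.mono (hI.2.1.uIcc_subset hI.2.2 ht)).intervalIntegrable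
  · exact hc.stronglyMeasurableAtFilter hI.1 t ht

/-- The set of times where the reparametrized time lies in a given interval. -/
theorem isTimeInterval_inter_preimage {I J : Set ℝ} (hI : IsTimeInterval I) (hJ : IsTimeInterval J)
    {τ w : ℝ → ℝ} (hτ : ∀ t ∈ I, HasDerivAt τ (w t) t) (hw : ∀ t ∈ I, 0 < w t) (h0 : τ 0 = 0) :
    IsTimeInterval (I ∩ τ ⁻¹' J) := by
  have hcont : ContinuousOn τ I := fun t ht ↦ (hτ t ht).continuousAt.continuousWithinAt
  have hmono : MonotoneOn τ I :=
    (strictMonoOn_of_deriv_pos hI.2.1.convex hcont fun t ht ↦ by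
      rw [(hτ t (interior_subset ht)).deriv]; exact hw t (interior_subset ht)).monotoneOn
  refine ⟨hcont.isOpen_inter_preimage hI.1 hJ.1, ⟨fun x hx y hy z hz ↦ ?_⟩, hI.2.2, ?_⟩
  · have hzI := hI.2.1.out hx.1 hy.1 hz
    exact ⟨hzI, hJ.2.1.out hx.2 hy.2 ⟨hmono hx.1 hzI hz.1, hmono hzI hy.1 hz.2⟩⟩
  · change τ 0 ∈ J
    rw [h0]
    exact hJ.2.2

/-- The radial equation, in terms of `μ`. -/
theorem radial_log_mu {α l a q β : ℝ} (hα : α ≠ 0) (hl : l ≠ 0) (hβ : β ≠ -1) {I : Set ℝ}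
    (hI : IsOpen I) (hpos : ∀ t ∈ I, 0 < mu α l a q β t) {t : ℝ} (ht : t ∈ I) :
    α * l * deriv (deriv (fun t ↦ Real.log (mu α l a q β t) / (α * (β + 1)))) t +
      α * (β + 1) / 2 * (α * l *
        deriv (fun t ↦ Real.log (mu α l a q β t) / (α * (β + 1))) t ^ 2 -
        (q - a ^ 2 / (α * l)) * (1 / mu α l a q β t) ^ 2) = 0 := by
  have hβ' : β + 1 ≠ 0 := fun h ↦ hβ (by linarith)
  have h1 : ∀ t ∈ I, HasDerivAt (fun t ↦ Real.log (mu α l a q β t) / (α * (β + 1)))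
      ((a / l * (β + 1) + 2 * (α / (4 * l) * q * (β + 1) ^ 2) * t) / mu α l a q β t /
        (α * (β + 1))) t := fun t ht ↦
    ((hasDerivAt_mu α l a q β t).log (hpos t ht).ne').div_const _
  have h2 : deriv (fun t ↦ Real.log (mu α l a q β t) / (α * (β + 1))) =ᶠ[𝓝 t] fun t ↦
      (a / l * (β + 1) + 2 * (α / (4 * l) * q * (β + 1) ^ 2) * t) / mu α l a q β t /
        (α * (β + 1)) := by
    filter_upwards [hI.mem_nhds ht] with s hs
    exact (h1 s hs).deriv
  have h3 := (((((hasDerivAt_id t).const_mul (2 * (α / (4 * l) * q * (β + 1) ^ 2))).const_add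
    (a / l * (β + 1))).div (hasDerivAt_mu α l a q β t) (hpos t ht).ne').div_const
      (α * (β + 1))).deriv
  have hμ := (hpos t ht).ne'
  rw [h2.deriv_eq, h2.eq_of_nhds]
  refine (congrArg₂ (· + ·) (congrArg (α * l * ·) h3) rfl).trans ?_
  have hdef : mu α l a q β t =
    1 + a / l * (β + 1) * t + α / (4 * l) * q * (β + 1) ^ 2 * t ^ 2 := rfl
  simp only [id_eq]
  -- With `k = α (β + 1)`, the claim reduces to `2 μ μ'' - μ'² = k² (q - a² / (α l)) / (α l)`. The
  -- left side is constant, being minus the discriminant of the quadratic `μ`.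
  field_simp
  rw [hdef]
  field_simp
  ring

end Mu

/-! ### The two directions of the correspondence, with initial data -/

section Main

variable {E : Type*} [NormedAddCommGroup E] [NormedSpace ℝ E]
  {M : Type*} [TopologicalSpace M] [ChartedSpace E M] [IsManifold 𝓘(ℝ, E) ∞ M]
  {m : ℝ → M → M} {g : PseudoRiemannianMetric E M} {f : M → ℝ} {α : ℝ}

omit [IsManifold 𝓘(ℝ, E) ∞ M] in
theorem IsGeodesicOn.mono
    {h : ∀ x : M, TangentSpace 𝓘(ℝ, E) x →L[ℝ] TangentSpace 𝓘(ℝ, E) x →L[ℝ] ℝ}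
    {γ : ℝ → M} {I I' : Set ℝ} (hγ : IsGeodesicOn h γ I) (hI : I' ⊆ I) : IsGeodesicOn h γ I' :=
  ⟨hγ.1.mono hI, fun t ht ↦ hγ.2 t (hI ht)⟩

theorem bijective_bil_conformal (hpos : ∀ x, 0 < f x) (hsurj : ∀ x, Function.Surjective (g.form x))
    (β : ℝ) (x : M) : Function.Bijective (bil (conformal g f β) x) := by
  have hc : f x ^ β ≠ 0 := (Real.rpow_pos_of_pos (hpos x) β).ne'
  constructor
  · rw [injective_iff_map_eq_zero]
    intro v hv
    refine g.nondegenerate x v fun (w : E) ↦ ?_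
    have : f x ^ β * bil g.form x v w = 0 := by
      rw [← bil_conformal, hv]
      rfl
    exact (mul_eq_zero.1 this).resolve_left hc
  · intro L
    obtain ⟨v, hv⟩ : ∃ v : E, bil g.form x v = (f x ^ β)⁻¹ • L := hsurj x ((f x ^ β)⁻¹ • L)
    refine ⟨v, ?_⟩
    refine ContinuousLinearMap.ext fun w ↦ ?_
    rw [bil_conformal, hv, smul_apply, smul_eq_mul, mul_inv_cancel_left₀ hc]

/-- Pythagoras: the vector is the component of `A` orthogonal to `P`, as `g(P, A) = a` and `g(P, P)
= α l`. This is the initial energy of the level set geodesic. -/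
theorem IsHomogeneousPair.bil_tangential (hm : IsFreePosAction E m)
    (hgf : IsHomogeneousPair m g f α) {l a : ℝ} {x : M} {A : E} (hx : f x = l)
    (ha : a = (tder f x : E →L[ℝ] ℝ) A) :
    bil g.form x (A - (a / (α * l)) • gen E m x) (A - (a / (α * l)) • gen E m x) =
      bil g.form x A A - a ^ 2 / (α * l) := by
  have hl : l ≠ 0 := hx ▸ (hgf.pos x).ne'
  have hα := hgf.degree_ne_zero
  simp only [map_sub, map_smul, sub_apply, smul_apply, smul_eq_mul, hgf.bil_gen,
    g.symmForms x A (gen E m x), hgf.tder_gen hm, ← ha, hx]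
  field_simp
  ring

/-- The logarithmic radial coordinate of a curve. -/
def radialLog (f : M → ℝ) (α l : ℝ) (γ : ℝ → M) (t : ℝ) : ℝ :=
  (Real.log (f (γ t)) - Real.log l) / α

theorem IsHomogeneousPair.eq_mul_exp_radialLog (hgf : IsHomogeneousPair m g f α) {l : ℝ}
    (hl : 0 < l) (γ : ℝ → M) (t : ℝ) : f (γ t) = l * Real.exp (α * radialLog f α l γ t) := by
  rw [radialLog, mul_div_cancel₀ _ hgf.degree_ne_zero, Real.exp_sub, Real.exp_log hl,
    Real.exp_log (hgf.pos _), mul_div_cancel₀ _ hl.ne']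

theorem IsHomogeneousPair.contDiffAt_radialLog (hgf : IsHomogeneousPair m g f α) {l : ℝ}
    {γ : ℝ → M} {t : ℝ} (hγ : ContMDiffAt 𝓘(ℝ, ℝ) 𝓘(ℝ, E) ∞ γ t) :
    ContDiffAt ℝ ∞ (radialLog f α l γ) t := by
  have : ContDiffAt ℝ ∞ (fun s ↦ f (γ s)) t := (hgf.smooth.contMDiffAt.comp t hγ).contDiffAt
  exact ((this.log (hgf.pos _).ne').sub contDiffAt_const).div_const α

omit [TopologicalSpace M] [ChartedSpace E M] [IsManifold 𝓘(ℝ, E) ∞ M] in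
theorem radialLog_zero {l : ℝ} {γ : ℝ → M} (h : f (γ 0) = l) : radialLog f α l γ 0 = 0 := by
  rw [radialLog, h, sub_self, zero_div]

theorem IsHomogeneousPair.deriv_radialLog_zero (hgf : IsHomogeneousPair m g f α) {l : ℝ}
    {γ : ℝ → M} (hγ : ContMDiffAt 𝓘(ℝ, ℝ) 𝓘(ℝ, E) ∞ γ 0) (h : f (γ 0) = l) :
    deriv (radialLog f α l γ) 0 = (tder f (γ 0) : E →L[ℝ] ℝ) (vel E γ 0) / (α * l) := by
  have h1 := vel_comp (φ := f) (u := γ) (t := 0) (hgf.mdifferentiableAt _)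
    (hγ.mdifferentiableAt (by simp))
  rw [vel_eq_deriv] at h1
  have : ContDiffAt ℝ ∞ (fun s ↦ f (γ s)) 0 := (hgf.smooth.contMDiffAt.comp 0 hγ).contDiffAt
  have h2 := ((((this.differentiableAt (by simp)).hasDerivAt).log (hgf.pos _).ne').sub_const
    (Real.log l)).div_const α
  refine h2.deriv.trans ?_
  rw [h1, h, div_div, mul_comm l]

variable [CompleteSpace E] {l a q β : ℝ} {x₀ : M} {A B : TangentSpace 𝓘(ℝ, E) x₀} {I : Set ℝ}
  {γ : ℝ → M}

/-- Along a geodesic of `f^β g`, the function `(f / l)^(β + 1)` equals `μ`. -/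
theorem IsGeodesicOn.exp_radialLog_eq_mu (hm : IsFreePosAction E m)
    (hgf : IsHomogeneousPair m g f α) (hx₀ : x₀ ∈ levelSet f l) (ha : a = dReal f x₀ A)
    (hq : q = g.form x₀ A A) (hI : IsTimeInterval I)
    (hγ : IsGeodesicOn (conformal g f β) γ I) (hv : velocity E γ 0 = ⟨x₀, A⟩) {t : ℝ}
    (ht : t ∈ I) : Real.exp (α * (β + 1) * radialLog f α l γ t) = mu α l a q β t := by
  obtain ⟨hγ0, hγv⟩ := velocity_eq_iff.1 hv
  have hl : f x₀ = l := hx₀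
  have hlpos : 0 < l := hl ▸ hgf.pos x₀
  have hα := hgf.degree_ne_zero
  have h2 : (2 : ℕ∞ω) ≤ ∞ := WithTop.coe_le_coe.2 le_top
  set σ := radialLog f α l γ with hσdef
  have hσ : ∀ t ∈ I, ContDiffAt ℝ ∞ σ t := fun t ht ↦
    hgf.contDiffAt_radialLog (hγ.contMDiffAt hI.1 ht)
  have hσ0 : σ 0 = 0 := radialLog_zero (by rw [hγ0, hl])
  have hσ' : deriv σ 0 = a / (α * l) := by
    rw [hσdef, hgf.deriv_radialLog_zero (hγ.contMDiffAt hI.1 hI.2.2) (by rw [hγ0, hl]), hγ0, hγv, ha]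
    rfl
  have hen : ∀ t ∈ I, energy (conformal g f β) γ t = l ^ β * q := by
    intro t ht
    rw [hI.eq_of_hasDerivAt_zero (fun s hs ↦ hγ.hasDerivAt_energy
      (smoothForms_conformal g hgf.smooth hgf.pos β) (symmForms_conformal g f β) hI.1 hs) ht,
      energy, bil_conformal, hγv, hγ0, hl, hq]
    rfl
  set k := α * (β + 1) with hk
  let W : ℝ → ℝ := fun t ↦ Real.exp (k * σ t)
  have hW : ∀ t ∈ I, ContDiffAt ℝ 2 W t := fun t ht ↦
    (contDiffAt_const.mul ((hσ t ht).of_le h2)).exp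
  have hW' : ∀ t ∈ I, HasDerivAt W (Real.exp (k * σ t) * (k * deriv σ t)) t := fun t ht ↦
    (((hσ t ht).differentiableAt (by simp)).hasDerivAt.const_mul k).exp
  have hW'' : ∀ t ∈ I, deriv (deriv W) t = 2 * (α / (4 * l) * q * (β + 1) ^ 2) := by
    intro t ht
    have h1 : deriv W =ᶠ[𝓝 t] fun t ↦ Real.exp (k * σ t) * (k * deriv σ t) := by
      filter_upwards [hI.1.mem_nhds ht] with s hs
      exact (hW' s hs).deriv
    have h3 := (hW' t ht).mul
      ((hasDerivAt_deriv_of_contDiffAt ((hσ t ht).of_le h2)).const_mul k)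
    have h4 : deriv (deriv W) t = Real.exp (k * σ t) * (k * deriv σ t) * (k * deriv σ t) +
        Real.exp (k * σ t) * (k * deriv (deriv σ) t) := by
      rw [h1.deriv_eq]
      exact h3.deriv
    -- Radial equation and energy together: `α l W'' = α l W (k² σ'² + k σ'')`, and the radial
    -- equation turns this into `(k² / 2) W (Q + α l σ'²)`, which is `(k² / 2) q` by conservation of
    -- energy.
    obtain ⟨Q, hQ1, hQ2⟩ := hγ.radial hm hgf hI.1 ht (hσ t ht)
      (fun s _ ↦ hgf.eq_mul_exp_radialLog hlpos γ s)
    rw [hen t ht, mul_assoc] at hQ2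
    have hQ3 := mul_left_cancel₀ (Real.rpow_pos_of_pos hlpos β).ne' hQ2
    have hαl : α * l ≠ 0 := mul_ne_zero hα hlpos.ne'
    refine mul_left_cancel₀ hαl ?_
    have e1 : α * l * (2 * (α / (4 * l) * q * (β + 1) ^ 2)) = k ^ 2 / 2 * q := by
      rw [hk]; field_simp; ring
    rw [e1, hQ3, h4]
    linear_combination (Real.exp (k * σ t) * k) * hQ1
  have := hI.eq_quadratic hW hW'' ht
  change W t = _
  rw [this, (hW' 0 hI.2.2).deriv, hσ']
  simp only [W, hσ0, mul_zero, Real.exp_zero, mu]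
  rw [hk]
  field_simp

/-- Positivity of `μ` comes for free, as `μ` is an exponential along the geodesic; for the same
reason the time change `τ' = e^{-k σ}` is the integral of `1 / μ`. -/
theorem exists_levelSet_geodesic_of_ne (hm : IsFreePosAction E m)
    (hgf : IsHomogeneousPair m g f α) (hx₀ : x₀ ∈ levelSet f l) (ha : a = dReal f x₀ A)
    (hq : q = g.form x₀ A A) (hB : B = A - (a / (α * l)) • generator E m x₀)
    (hI : IsTimeInterval I) (hβ : β ≠ -1)
    (hγ : IsGeodesicOn (conformal g f β) γ I) (hv : velocity E γ 0 = ⟨x₀, A⟩) :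
    (∀ t ∈ I, 0 < mu α l a q β t) ∧
      ∃ (J : Set ℝ) (y : ℝ → M), IsTimeInterval J ∧
        IsSubmanifoldGeodesicOn g.form (levelSet f l) y J ∧
        velocity E y 0 = ⟨x₀, B⟩ ∧
        ∀ t ∈ I, (∫ τ in (0 : ℝ)..t, 1 / mu α l a q β τ) ∈ J ∧
          γ t = m (mu α l a q β t ^ (1 / (α * (β + 1))))
            (y (∫ τ in (0 : ℝ)..t, 1 / mu α l a q β τ)) := by
  have hμ := fun t (ht : t ∈ I) ↦ hγ.exp_radialLog_eq_mu hm hgf hx₀ ha hq hI hv ht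
  have hpos : ∀ t ∈ I, 0 < mu α l a q β t := fun t ht ↦ hμ t ht ▸ Real.exp_pos _
  obtain ⟨hγ0, hγv⟩ := velocity_eq_iff.1 hv
  have hl : f x₀ = l := hx₀
  have hlpos : 0 < l := hl ▸ hgf.pos x₀
  have hk : α * (β + 1) ≠ 0 := mul_ne_zero hgf.degree_ne_zero fun h ↦ hβ (by linarith)
  obtain ⟨J, y, hJ, hy, hy0, hyv, hyγ⟩ := hγ.exists_levelSet_geodesic hm hgf (l := l) hI
    (σ := radialLog f α l γ) (τ := fun t ↦ ∫ τ in (0 : ℝ)..t, 1 / mu α l a q β τ)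
    (fun t ht ↦ hgf.contDiffAt_radialLog (hγ.contMDiffAt hI.1 ht))
    (fun s _ ↦ hgf.eq_mul_exp_radialLog hlpos γ s) (radialLog_zero (by rw [hγ0, hl]))
    (by simp) (fun t ht ↦ by
      have := hasDerivAt_integral_inv_mu hI hpos ht
      rwa [one_div, ← hμ t ht, ← Real.exp_neg] at this)
  refine ⟨hpos, J, y, hJ, hy, velocity_eq_iff.2 ⟨hy0.trans hγ0, ?_⟩, fun t ht ↦ ⟨(hyγ t ht).1, ?_⟩⟩
  · rw [hyv, hgf.deriv_radialLog_zero (hγ.contMDiffAt hI.1 hI.2.2) (by rw [hγ0, hl]), hγ0, hγv, hB,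
      ha]
    rfl
  · rw [← hμ t ht, ← Real.exp_mul, mul_one_div, mul_div_cancel_left₀ _ hk]
    exact (hyγ t ht).2

/-- The initial energy of `y` is `g(B, B)`, which makes the required radial equation that of
`radial_log_mu`; and `σ'(0) = a / (α l)` restores the component along `P` that was removed from `A`.
-/
theorem isGeodesicOn_conformal_of_ne (hm : IsFreePosAction E m)
    (hgf : IsHomogeneousPair m g f α) (hx₀ : x₀ ∈ levelSet f l) (ha : a = dReal f x₀ A)
    (hq : q = g.form x₀ A A) (hB : B = A - (a / (α * l)) • generator E m x₀)
    (hI : IsTimeInterval I) (hβ : β ≠ -1) (hpos : ∀ t ∈ I, 0 < mu α l a q β t)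
    {J : Set ℝ} {y : ℝ → M} (hJ : IsTimeInterval J)
    (hy : IsSubmanifoldGeodesicOn g.form (levelSet f l) y J) (hyv : velocity E y 0 = ⟨x₀, B⟩)
    (hγ : ∀ t ∈ I, (∫ τ in (0 : ℝ)..t, 1 / mu α l a q β τ) ∈ J ∧
      γ t = m (mu α l a q β t ^ (1 / (α * (β + 1))))
        (y (∫ τ in (0 : ℝ)..t, 1 / mu α l a q β τ))) :
    IsGeodesicOn (conformal g f β) γ I ∧ velocity E γ 0 = ⟨x₀, A⟩ := by
  obtain ⟨hy0, hyv⟩ := velocity_eq_iff.1 hyv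
  have hl : f x₀ = l := hx₀
  have hlpos : 0 < l := hl ▸ hgf.pos x₀
  have hβ' : β + 1 ≠ 0 := fun h ↦ hβ (by linarith)
  have hα := hgf.degree_ne_zero
  have hk : α * (β + 1) ≠ 0 := mul_ne_zero hα hβ'
  let σ : ℝ → ℝ := fun t ↦ Real.log (mu α l a q β t) / (α * (β + 1))
  have hkσ : ∀ t ∈ I, Real.exp (-(α * (β + 1) * σ t)) = 1 / mu α l a q β t := by
    intro t ht
    rw [mul_div_cancel₀ _ hk, Real.exp_neg, Real.exp_log (hpos t ht), one_div]
  have hen : energy g.form y 0 = q - a ^ 2 / (α * l) := by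
    rw [energy, hy0, hyv, hB, hq]
    exact hgf.bil_tangential hm hl ha
  have hσ' : deriv σ 0 = a / (α * l) := by
    have := ((hasDerivAt_mu α l a q β 0).log (hpos 0 hI.2.2).ne').div_const (α * (β + 1))
    refine this.deriv.trans ?_
    rw [mu_zero]
    field_simp
    ring
  obtain ⟨h1, h2, h3⟩ := hy.isGeodesicOn_conformal hm hgf (β := β) (γ := γ) hI hJ (σ := σ)
    (τ := fun t ↦ ∫ τ in (0 : ℝ)..t, 1 / mu α l a q β τ)
    (fun t ht ↦ (((contDiff_mu α l a q β).contDiffAt).log (hpos t ht).ne').div_const _)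
    (by simp [σ, mu_zero]) (by simp)
    (fun t ht ↦ by rw [hkσ t ht]; exact hasDerivAt_integral_inv_mu hI hpos ht)
    (fun t ht ↦ by rw [hkσ t ht, hen]; exact radial_log_mu hα hlpos.ne' hβ hI.1 hpos ht)
    (fun t ht ↦ ⟨(hγ t ht).1, by
      rw [(hγ t ht).2, Real.rpow_def_of_pos (hpos t ht), mul_one_div]⟩)
  refine ⟨h1, velocity_eq_iff.2 ⟨h2.trans hy0, ?_⟩⟩
  rw [h3, hy0, hyv, hσ', hB]
  exact add_sub_cancel ((a / (α * l)) • gen E m x₀) (A : E)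

/-- For `β = -1` the warping exponent is zero and `f⁻¹ g` is locally a product metric: the radial
equation is `σ'' = 0`, and the projection is a geodesic without change of time. -/
theorem exists_levelSet_geodesic_of_eq (hm : IsFreePosAction E m)
    (hgf : IsHomogeneousPair m g f α) (hx₀ : x₀ ∈ levelSet f l) (ha : a = dReal f x₀ A)
    (hB : B = A - (a / (α * l)) • generator E m x₀)
    (hI : IsTimeInterval I) (hβ : β = -1)
    (hγ : IsGeodesicOn (conformal g f β) γ I) (hv : velocity E γ 0 = ⟨x₀, A⟩) :
    ∃ (J : Set ℝ) (y : ℝ → M), IsTimeInterval J ∧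
      IsSubmanifoldGeodesicOn g.form (levelSet f l) y J ∧
      velocity E y 0 = ⟨x₀, B⟩ ∧
      ∀ t ∈ I, t ∈ J ∧ γ t = m (Real.exp (a / (α * l) * t)) (y t) := by
  obtain ⟨hγ0, hγv⟩ := velocity_eq_iff.1 hv
  have hl : f x₀ = l := hx₀
  have hlpos : 0 < l := hl ▸ hgf.pos x₀
  have hk : α * (β + 1) = 0 := by rw [hβ]; ring
  set σ := radialLog f α l γ with hσdef
  have hσ : ∀ t ∈ I, ContDiffAt ℝ ∞ σ t := fun t ht ↦
    hgf.contDiffAt_radialLog (hγ.contMDiffAt hI.1 ht)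
  have hσ0 : σ 0 = 0 := radialLog_zero (by rw [hγ0, hl])
  have hσ' : deriv σ 0 = a / (α * l) := by
    rw [hσdef, hgf.deriv_radialLog_zero (hγ.contMDiffAt hI.1 hI.2.2) (by rw [hγ0, hl]), hγ0, hγv, ha]
    rfl
  have hlin : ∀ t ∈ I, σ t = a / (α * l) * t := by
    intro t ht
    have := hI.eq_quadratic (c := 0) (fun s hs ↦ (hσ s hs).of_le (WithTop.coe_le_coe.2 le_top))
      (fun s hs ↦ by
        obtain ⟨Q, hQ, -⟩ := hγ.radial hm hgf hI.1 hs (hσ s hs)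
          (fun s _ ↦ hgf.eq_mul_exp_radialLog hlpos γ s)
        rw [hk, zero_div, zero_mul, add_zero] at hQ
        rw [mul_zero]
        exact (mul_eq_zero.1 hQ).resolve_left (mul_ne_zero hgf.degree_ne_zero hlpos.ne')) ht
    rw [this, hσ0, hσ']
    ring
  obtain ⟨J, y, hJ, hy, hy0, hyv, hyγ⟩ := hγ.exists_levelSet_geodesic hm hgf (l := l) hI
    (σ := σ) (τ := fun t ↦ t) hσ
    (fun s _ ↦ hgf.eq_mul_exp_radialLog hlpos γ s) hσ0 rfl (fun t ht ↦ by
      rw [hk, zero_mul, neg_zero, Real.exp_zero]; exact hasDerivAt_id' t)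
  refine ⟨J, y, hJ, hy, velocity_eq_iff.2 ⟨hy0.trans hγ0, ?_⟩, fun t ht ↦ ⟨(hyγ t ht).1, ?_⟩⟩
  · rw [hyv, hσ', hγ0, hγv, hB]
    rfl
  · rw [← hlin t ht]
    exact (hyγ t ht).2

theorem isGeodesicOn_conformal_of_eq (hm : IsFreePosAction E m)
    (hgf : IsHomogeneousPair m g f α) (hB : B = A - (a / (α * l)) • generator E m x₀)
    (hI : IsTimeInterval I) (hβ : β = -1)
    {J : Set ℝ} {y : ℝ → M} (hJ : IsTimeInterval J)
    (hy : IsSubmanifoldGeodesicOn g.form (levelSet f l) y J) (hyv : velocity E y 0 = ⟨x₀, B⟩)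
    (hγ : ∀ t ∈ I, t ∈ J ∧ γ t = m (Real.exp (a / (α * l) * t)) (y t)) :
    IsGeodesicOn (conformal g f β) γ I ∧ velocity E γ 0 = ⟨x₀, A⟩ := by
  obtain ⟨hy0, hyv⟩ := velocity_eq_iff.1 hyv
  have hk : α * (β + 1) = 0 := by rw [hβ]; ring
  have hd : ∀ t, HasDerivAt (fun t : ℝ ↦ a / (α * l) * t) (a / (α * l)) t := fun t ↦ by
    simpa using (hasDerivAt_id t).const_mul (a / (α * l))
  have hd1 : deriv (fun t : ℝ ↦ a / (α * l) * t) = fun _ ↦ a / (α * l) :=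
    funext fun t ↦ (hd t).deriv
  obtain ⟨h1, h2, h3⟩ := hy.isGeodesicOn_conformal hm hgf (β := β) (γ := γ) hI hJ
    (σ := fun t ↦ a / (α * l) * t) (τ := fun t ↦ t)
    (fun t _ ↦ contDiffAt_const.mul contDiffAt_id) (by simp) rfl
    (fun t ht ↦ by rw [hk, zero_mul, neg_zero, Real.exp_zero]; exact hasDerivAt_id' t)
    (fun t ht ↦ by rw [hd1, hk]; simp) hγ
  refine ⟨h1, velocity_eq_iff.2 ⟨h2.trans hy0, ?_⟩⟩
  rw [h3, hy0, hyv, hd1, hB]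
  exact add_sub_cancel ((a / (α * l)) • gen E m x₀) (A : E)

theorem IsGeodesicOn.eqOn_conformal [T2Space M] (hgf : IsHomogeneousPair m g f α)
    (hsurj : ∀ x, Function.Surjective (g.form x)) {γ' : ℝ → M} (hI : IsTimeInterval I)
    (hγ : IsGeodesicOn (conformal g f β) γ I) (hγ' : IsGeodesicOn (conformal g f β) γ' I)
    (hv : velocity E γ 0 = ⟨x₀, A⟩) (hv' : velocity E γ' 0 = ⟨x₀, A⟩) : EqOn γ γ' I := by
  obtain ⟨h0, h1⟩ := velocity_eq_iff.1 hv
  obtain ⟨h0', h1'⟩ := velocity_eq_iff.1 hv'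
  exact hγ.eqOn (smoothForms_conformal g hgf.smooth hgf.pos β) (symmForms_conformal g f β)
    (bijective_bil_conformal hgf.pos hsurj β) hI hγ' (h0.trans h0'.symm) (h1.trans h1'.symm)

end Main

end HomogPair

end

theorem proposition3p16
    {E : Type*} [NormedAddCommGroup E] [NormedSpace ℝ E] [CompleteSpace E]
    {M : Type*} [TopologicalSpace M] [T2Space M] [ChartedSpace E M] [IsManifold 𝓘(ℝ, E) ∞ M]
    (m : ℝ → M → M) (hm : HomogPair.IsFreePosAction E m)
    (g : HomogPair.PseudoRiemannianMetric E M) (f : M → ℝ) (α : ℝ)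
    (hgf : HomogPair.IsHomogeneousPair m g f α)
    (l β : ℝ) (x₀ : M) (hx₀ : x₀ ∈ HomogPair.levelSet f l)
    (A : TangentSpace 𝓘(ℝ, E) x₀)
    -- `a = df(A)`, `q = g(A, A)`, and `B` is the component of `A` tangent to the level set
    (a q : ℝ) (ha : a = HomogPair.dReal f x₀ A) (hq : q = g.form x₀ A A)
    (B : TangentSpace 𝓘(ℝ, E) x₀)
    (hB : B = A - (a / (α * l)) • HomogPair.generator E m x₀)
    (I : Set ℝ) (hI : HomogPair.IsTimeInterval I) (γ : ℝ → M) :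
    (β ≠ -1 →
      -- `γ` is a geodesic with the given initial data if and only if it is given by the formula
      ((HomogPair.IsGeodesicOn (HomogPair.conformal g f β) γ I ∧
          HomogPair.velocity E γ 0 = ⟨x₀, A⟩) ↔
        (∀ t ∈ I, 0 < HomogPair.mu α l a q β t) ∧
        ∃ (J : Set ℝ) (y : ℝ → M), HomogPair.IsTimeInterval J ∧
          HomogPair.IsSubmanifoldGeodesicOn g.form (HomogPair.levelSet f l) y J ∧
          HomogPair.velocity E y 0 = ⟨x₀, B⟩ ∧
          ∀ t ∈ I, (∫ τ in (0 : ℝ)..t, 1 / HomogPair.mu α l a q β τ) ∈ J ∧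
            γ t = m (HomogPair.mu α l a q β t ^ (1 / (α * (β + 1))))
              (y (∫ τ in (0 : ℝ)..t, 1 / HomogPair.mu α l a q β τ))) ∧
      -- geodesics being unique, the formula holds with any geodesic of the level set
      ((∀ x, Function.Surjective (g.form x)) →
        HomogPair.IsGeodesicOn (HomogPair.conformal g f β) γ I →
        HomogPair.velocity E γ 0 = ⟨x₀, A⟩ →
        ∀ (J : Set ℝ) (y : ℝ → M), HomogPair.IsTimeInterval J →
          HomogPair.IsSubmanifoldGeodesicOn g.form (HomogPair.levelSet f l) y J →
          HomogPair.velocity E y 0 = ⟨x₀, B⟩ →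
          ∀ t ∈ I, (∫ τ in (0 : ℝ)..t, 1 / HomogPair.mu α l a q β τ) ∈ J →
            γ t = m (HomogPair.mu α l a q β t ^ (1 / (α * (β + 1))))
              (y (∫ τ in (0 : ℝ)..t, 1 / HomogPair.mu α l a q β τ)))) ∧
    (β = -1 →
      ((HomogPair.IsGeodesicOn (HomogPair.conformal g f β) γ I ∧
          HomogPair.velocity E γ 0 = ⟨x₀, A⟩) ↔
        ∃ (J : Set ℝ) (y : ℝ → M), HomogPair.IsTimeInterval J ∧
          HomogPair.IsSubmanifoldGeodesicOn g.form (HomogPair.levelSet f l) y J ∧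
          HomogPair.velocity E y 0 = ⟨x₀, B⟩ ∧
          ∀ t ∈ I, t ∈ J ∧ γ t = m (Real.exp (a / (α * l) * t)) (y t)) ∧
      ((∀ x, Function.Surjective (g.form x)) →
        HomogPair.IsGeodesicOn (HomogPair.conformal g f β) γ I →
        HomogPair.velocity E γ 0 = ⟨x₀, A⟩ →
        ∀ (J : Set ℝ) (y : ℝ → M), HomogPair.IsTimeInterval J →
          HomogPair.IsSubmanifoldGeodesicOn g.form (HomogPair.levelSet f l) y J →
          HomogPair.velocity E y 0 = ⟨x₀, B⟩ →
          ∀ t ∈ I, t ∈ J → γ t = m (Real.exp (a / (α * l) * t)) (y t))) := by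
  refine ⟨fun hβ ↦ ⟨⟨fun h ↦ ?_, fun h ↦ ?_⟩, fun hsurj hγ hv J y hJ hy hyv t ht htJ ↦ ?_⟩,
    fun hβ ↦ ⟨⟨fun h ↦ ?_, fun h ↦ ?_⟩, fun hsurj hγ hv J y hJ hy hyv t ht htJ ↦ ?_⟩⟩
  · exact HomogPair.exists_levelSet_geodesic_of_ne hm hgf hx₀ ha hq hB hI hβ h.1 h.2
  · obtain ⟨hpos, J, y, hJ, hy, hyv, hγ⟩ := h
    exact HomogPair.isGeodesicOn_conformal_of_ne hm hgf hx₀ ha hq hB hI hβ hpos hJ hy hyv hγ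
  · have hpos := (HomogPair.exists_levelSet_geodesic_of_ne hm hgf hx₀ ha hq hB hI hβ hγ hv).1
    -- On the times that the given `y` reaches, an interval because the time change is monotone, the
    -- lift of `y` is a geodesic with the same initial data; uniqueness identifies it with `γ`.
    have hI' := HomogPair.isTimeInterval_inter_preimage hI hJ
      (fun t ht ↦ HomogPair.hasDerivAt_integral_inv_mu hI hpos ht)
      (fun t ht ↦ one_div_pos.2 (hpos t ht)) intervalIntegral.integral_same
    obtain ⟨hγ', hv'⟩ := HomogPair.isGeodesicOn_conformal_of_ne (β := β)
      (γ := fun t ↦ m (HomogPair.mu α l a q β t ^ (1 / (α * (β + 1))))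
        (y (∫ τ in (0 : ℝ)..t, 1 / HomogPair.mu α l a q β τ)))
      hm hgf hx₀ ha hq hB hI' hβ (fun t ht ↦ hpos t ht.1) hJ hy hyv fun t ht ↦ ⟨ht.2, rfl⟩
    exact (hγ.mono inter_subset_left).eqOn_conformal hgf hsurj hI' hγ' hv hv' ⟨ht, htJ⟩
  · exact HomogPair.exists_levelSet_geodesic_of_eq hm hgf hx₀ ha hB hI hβ h.1 h.2
  · obtain ⟨J, y, hJ, hy, hyv, hγ⟩ := h
    exact HomogPair.isGeodesicOn_conformal_of_eq hm hgf hB hI hβ hJ hy hyv hγ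
  · have hI' : HomogPair.IsTimeInterval (I ∩ J) :=
      ⟨hI.1.inter hJ.1, hI.2.1.inter hJ.2.1, hI.2.2, hJ.2.2⟩
    obtain ⟨hγ', hv'⟩ := HomogPair.isGeodesicOn_conformal_of_eq (β := β)
      (γ := fun t ↦ m (Real.exp (a / (α * l) * t)) (y t))
      hm hgf hB hI' hβ hJ hy hyv fun t ht ↦ ⟨ht.2, rfl⟩
    exact (hγ.mono inter_subset_left).eqOn_conformal hgf hsurj hI' hγ' hv hv' ⟨ht, htJ⟩
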